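/- Let $K$ be a number field with ring of integers $\mathcal{O}_K$, fix an algebraic closure $\overline{K}$ of $K$, and put $G_K=\operatorname{Gal}(\overline{K}/K)$. Let $E$ be an elliptic curve over $K$ with $j$-invariant $j$, let $\mathfrak{q}$ be a nonzero prime ideal of $\mathcal{O}_K$ with normalised additive valuation $\operatorname{ord}_{\mathfrak{q}}$, and let $p$ be a prime number. Let $E[p]$ be the $p$-torsion subgroup of $E(\overline{K})$, and let $\overline{\rho}_{E,p} : G_K \to \operatorname{Aut}_{\mathbb{Z}/p\mathbb{Z}}(E[p])$ be the mod $p$ Galois representation of $E$, given by $\overline{\rho}_{E,p}(\sigma)(P)=\sigma(P)$. Let $\mathfrak{P}$ be any prime above $\mathfrak{q}$ of the integral closure $\overline{\mathcal{O}}$ of $\mathcal{O}_K$ in $\overline{K}$, and let \[ I_{\mathfrak{q}} = \{\sigma \in G_K : \sigma(\alpha)-\alpha \in \mathfrak{P} \text{ for all } \alpha \in \overline{\mathcal{O}}\} \] be the corresponding inertia subgroup at $\mathfrak{q}$. Suppose that \[ \operatorname{ord}_{\mathfrak{q}}(j)<0 \qquad\text{and}\qquad p \nmid \operatorname{ord}_{\mathfrak{q}}(j).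 \] Then $\overline{\rho}_{E,p}(I_{\mathfrak{q}})$ is a finite group and $p$ divides its order. -/

import Mathlib

open scoped NumberField

noncomputable section

namespace EllipticGalois

/-- The normalised additive valuation `ord_𝔮` on a number field `K` at a nonzero prime `𝔮` of its
ring of integers (with the convention `ord 𝔮 0 = 0`). Mathlib's `𝔮.valuation K x` is
multiplicative: it equals `exp (-ord_𝔮 x)` for `x ≠ 0`. -/
def ord {K : Type*} [Field K] [NumberField K] (𝔮 : IsDedekindDomain.HeightOneSpectrum (𝓞 K))
    (x : K) : ℤ :=
  -WithZero.log (𝔮.valuation K x)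

/-- The absolute Galois group `Gal(K̄/K)`. -/
abbrev AbsGal (K : Type*) [Field K] : Type _ :=
  AlgebraicClosure K ≃ₐ[K] AlgebraicClosure K

/-- The ring of all algebraic integers in `K̄`. -/
abbrev IntBar (K : Type*) [Field K] : Type _ :=
  integralClosure (𝓞 K) (AlgebraicClosure K)

/-- The inertia subgroup of `Gal(K̄/K)` at a prime `𝔓` of the ring of algebraic integers of `K̄`:
all `σ` with `σ α ≡ α` modulo `𝔓` for every algebraic integer `α`. -/
abbrev inertiaSubgroup {K : Type*} [Field K] (𝔓 : Ideal (IntBar K)) : Subgroup (AbsGal K) :=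
  𝔓.inertia (AbsGal K)

/-- The points `E(K̄)`, in affine coordinates together with the point at infinity. -/
abbrev PointBar {K : Type*} [Field K] (E : WeierstrassCurve K) : Type _ :=
  (E.baseChange (AlgebraicClosure K)).toAffine.Point

open scoped Classical in
/-- The group `E[N]` of `N`-torsion points of `E(K̄)`. -/
abbrev Torsion {K : Type*} [Field K] (E : WeierstrassCurve K) (N : ℕ) : AddSubgroup (PointBar E) :=
  AddSubgroup.torsionBy (PointBar E) (N : ℤ)

open scoped Classical in
/-- `E[N]` as a module over `ℤ/Nℤ`. -/
instance torsionModule {K : Type*} [Field K] (E : WeierstrassCurve K) (N : ℕ) :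
    Module (ZMod N) (Torsion E N) :=
  AddSubgroup.torsionBy.zmodModule

open scoped Classical in
/-- The map `P ↦ σ(P)` on `E(K̄)`, where `σ` acts on the coordinates of `P`. -/
def galPoint {K : Type*} [Field K] (E : WeierstrassCurve K) (σ : AbsGal K) :
    PointBar E →+ PointBar E :=
  WeierstrassCurve.Affine.Point.map (W' := E.toAffine) (S := K) σ.toAlgHom

open scoped Classical in
theorem galPoint_mem_torsion {K : Type*} [Field K] (E : WeierstrassCurve K) (N : ℕ)
    (σ : AbsGal K) {P : PointBar E} (hP : P ∈ Torsion E N) : galPoint E σ P ∈ Torsion E N := by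
  rw [AddSubgroup.torsionBy.nsmul_iff] at hP ⊢
  rw [← map_nsmul, hP, map_zero]

open scoped Classical in
/-- The `ℤ/Nℤ`-linear map `P ↦ σ(P)` on `E[N]`. -/
def galTorsion {K : Type*} [Field K] (E : WeierstrassCurve K) (N : ℕ) (σ : AbsGal K) :
    Module.End (ZMod N) (Torsion E N) :=
  AddMonoidHom.toZModLinearMap N
    (((galPoint E σ).comp (Torsion E N).subtype).codRestrict (Torsion E N)
      fun P ↦ galPoint_mem_torsion E N σ P.2)

open scoped Classical in
theorem coe_galTorsion {K : Type*} [Field K] (E : WeierstrassCurve K) (N : ℕ) (σ : AbsGal K)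
    (P : Torsion E N) : (galTorsion E N σ P : PointBar E) = galPoint E σ P := rfl

open scoped Classical in
/-- The mod `N` Galois representation of `E`, with values in the automorphism group of the
`ℤ/Nℤ`-module `E[N]`. -/
def modRep {K : Type*} [Field K] (E : WeierstrassCurve K) (N : ℕ) :
    AbsGal K →* LinearMap.GeneralLinearGroup (ZMod N) (Torsion E N) :=
  MonoidHom.toHomUnits
    { toFun := galTorsion E N
      map_one' := by
        ext1 P
        apply Subtype.ext
        rw [coe_galTorsion]
        rcases P with ⟨_ | _, _⟩ <;> rfl
      map_mul' := fun σ τ ↦ by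
        ext1 P
        apply Subtype.ext
        rw [Module.End.mul_apply, coe_galTorsion, coe_galTorsion, coe_galTorsion]
        rcases P with ⟨_ | _, _⟩ <;> rfl }

end EllipticGalois

end

/-! Where `j` is not integral, `E` is locally a twist of a Tate curve `u ∈ K̄ˣ / Q^ℤ` with `v(Q) =
-v(j)`, and some `p`-torsion points are `p`-th roots of `Q`; these force ramification divisible by
`p`. The proof recovers this from `x`-coordinates and valuations alone, without uniformisation.

Put `δ = Δ / c₆²` and `n = v(δ) = -v(j) > 0`. An affine coordinate `z = (x - r) / w` over `K` brings
the `b`-invariants to those of `y² + xy = x³ - 36δx - δ` (`isTateCoordinate`). As on the Tate curve,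
a point with `v(z) = t` has multiples with `v(z(mP)) = min(mt, n - mt)`, for `t` in a suitable
annulus (`val_nsmul`). For `p = 2q + 1` the valuation of `z(2qP) - z(P)` is then `min(n - 2qt, t)`,
whose slope jumps at `t = n / p`. A rational function without zeros or poles on an annulus has
affine valuation there, so the jump yields a root, that is, a `p`-torsion point with `v(z) = v(δ) /
p` (`exists_torsion_odd`). For `p = 2` the same argument applied to the 2-division cubic gives `v(z)
= v(4δ) / 2` (`exists_torsion_two`).

Since `p` does not divide `ord δ` (or `ord (4δ)` if `p = 2`), the ramification index of the normal
closure `L` of `K(z)` is divisible by `p`, hence so is the order of its inertia group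
(`dvd_card_inertia`). That group is the image of the inertia group of `K̄`
(`exists_inertia_restrictNormalHom_eq`), and restriction to `L` factors through the mod `p`
representation, because its kernel fixes `z`. -/

namespace WeierstrassCurve.Affine.Point

/-! ### The group law on `x`-coordinates. -/

section

variable {F : Type*} [Field F] {W : WeierstrassCurve.Affine F}

theorem sq_sub_negY {x y : F} (h : W.Equation x y) :
    (y - W.negY x y) ^ 2 = 4 * x ^ 3 + W.b₂ * x ^ 2 + 2 * W.b₄ * x + W.b₆ := by
  rw [equation_iff] at h
  simp only [negY, b₂, b₄, b₆]
  linear_combination 4 * h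

theorem eq_or_eq_neg_of_X_eq {x y y' : F} (h : W.Nonsingular x y) (h' : W.Nonsingular x y') :
    some x y h = some x y' h' ∨ some x y h = -some x y' h' := by
  rcases Y_eq_of_X_eq h.1 h'.1 rfl with rfl | rfl
  · exact .inl rfl
  · exact .inr (by simp [neg_some])

/-- `l` and `m` are the slopes of the lines through `P, Q` and `P, -Q`. Symmetric functions of `x(P
+ Q)` and `x(P - Q)` are unchanged by `P ↦ -P` and `Q ↦ -Q`, so they are rational in `x₁, x₂` alone.
-/
theorem sum_identity {x₁ y₁ x₂ y₂ l m : F} (e₁ : W.Equation x₁ y₁) (e₂ : W.Equation x₂ y₂)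
    (hl : l * (x₁ - x₂) = y₁ - y₂) (hm : m * (x₁ - x₂) = y₁ - W.negY x₂ y₂) :
    (x₁ - x₂) ^ 2 * (W.addX x₁ x₂ l + W.addX x₁ x₂ m) =
        2 * x₁ * x₂ * (x₁ + x₂) + W.b₂ * (x₁ * x₂) + W.b₄ * (x₁ + x₂) + W.b₆ := by
  rw [equation_iff] at e₁ e₂
  simp only [addX, negY, b₂, b₄, b₆] at *
  grind

theorem prod_identity {x₁ y₁ x₂ y₂ l m : F} (e₁ : W.Equation x₁ y₁) (e₂ : W.Equation x₂ y₂)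
    (hx : x₁ - x₂ ≠ 0)
    (hl : l * (x₁ - x₂) = y₁ - y₂) (hm : m * (x₁ - x₂) = y₁ - W.negY x₂ y₂) :
    (x₁ - x₂) ^ 2 * (W.addX x₁ x₂ l * W.addX x₁ x₂ m) =
      x₁ ^ 2 * x₂ ^ 2 - W.b₄ * (x₁ * x₂) - W.b₆ * (x₁ + x₂) - W.b₈ := by
  rw [equation_iff] at e₁ e₂
  simp only [addX, negY, b₄, b₆, b₈] at *
  -- The difference of the two curve equations contains a factor `x₁ - x₂`, so `l * m` has only a
  -- simple pole there.
  have hlm : l * m * (x₁ - x₂) =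
      x₁ ^ 2 + x₁ * x₂ + x₂ ^ 2 + W.a₂ * (x₁ + x₂) + W.a₄ - W.a₁ * y₁ :=
    mul_right_cancel₀ hx (by linear_combination m * (x₁ - x₂) * hl + (y₁ - y₂) * hm + e₁ - e₂)
  have h : ∀ {d c L M T : F}, l * d = L → m * d = M → l * m * d = T →
      d ^ 2 * ((l ^ 2 + W.a₁ * l - c) * (m ^ 2 + W.a₁ * m - c)) =
        T ^ 2 + W.a₁ * T * (L + M) - c * (L ^ 2 + M ^ 2) + W.a₁ ^ 2 * T * d
          - W.a₁ * c * (L + M) * d + c ^ 2 * d ^ 2 := by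
    rintro d c L M T rfl rfl rfl
    ring
  have := h (c := W.a₂ + x₁ + x₂) hl hm hlm
  linear_combination this + (-W.a₁ ^ 2 - 2 * (W.a₂ + x₁ + x₂)) * e₁ - 2 * (W.a₂ + x₁ + x₂) * e₂

end

section

variable {F : Type*} [Field F] [DecidableEq F] {W : WeierstrassCurve.Affine F}

/-- The `x`-coordinates of `P + Q` and `P - Q` in terms of those of `P` and `Q`. -/
theorem add_sub_eq_some {x₁ y₁ x₂ y₂ : F} (h₁ : W.Nonsingular x₁ y₁) (h₂ : W.Nonsingular x₂ y₂)
    (hx : x₁ ≠ x₂) :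
    ∃ (x y : F) (h : W.Nonsingular x y) (x' y' : F) (h' : W.Nonsingular x' y'),
      some x₁ y₁ h₁ + some x₂ y₂ h₂ = some x y h ∧
      some x₁ y₁ h₁ - some x₂ y₂ h₂ = some x' y' h' ∧
      (x₁ - x₂) ^ 2 * (x + x') =
        2 * x₁ * x₂ * (x₁ + x₂) + W.b₂ * (x₁ * x₂) + W.b₄ * (x₁ + x₂) + W.b₆ ∧
      (x₁ - x₂) ^ 2 * (x * x') =
        x₁ ^ 2 * x₂ ^ 2 - W.b₄ * (x₁ * x₂) - W.b₆ * (x₁ + x₂) - W.b₈ := by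
  have hd : x₁ - x₂ ≠ 0 := sub_ne_zero.2 hx
  have hs := add_of_X_ne (h₁ := h₁) (h₂ := (nonsingular_neg x₂ y₂).2 h₂) hx
  rw [← neg_some h₂, ← sub_eq_add_neg] at hs
  have hl : W.slope x₁ x₂ y₁ y₂ * (x₁ - x₂) = y₁ - y₂ := by
    rw [slope_of_X_ne hx, div_mul_cancel₀ _ hd]
  have hm : W.slope x₁ x₂ y₁ (W.negY x₂ y₂) * (x₁ - x₂) = y₁ - W.negY x₂ y₂ := by
    rw [slope_of_X_ne hx, div_mul_cancel₀ _ hd]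
  exact ⟨_, _, _, _, _, _, add_of_X_ne hx, hs, sum_identity h₁.1 h₂.1 hl hm,
    prod_identity h₁.1 h₂.1 hd hl hm⟩

theorem two_nsmul_eq_zero_iff {x y : F} (h : W.Nonsingular x y) :
    2 • some x y h = 0 ↔ 4 * x ^ 3 + W.b₂ * x ^ 2 + 2 * W.b₄ * x + W.b₆ = 0 := by
  rw [← sq_sub_negY h.1, sq_eq_zero_iff, sub_eq_zero, two_nsmul]
  by_cases hy : y = W.negY x y
  · exact iff_of_true (add_self_of_Y_eq hy) hy
  · refine iff_of_false ?_ hy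
    rw [add_self_of_Y_ne hy]
    exact some_ne_zero _

/-- The duplication formula for the `x`-coordinate. -/
theorem two_nsmul_eq_some {x y : F} (h : W.Nonsingular x y) (h2 : 2 • some x y h ≠ 0) :
    ∃ (x' y' : F) (h' : W.Nonsingular x' y'), 2 • some x y h = some x' y' h' ∧
      (4 * x ^ 3 + W.b₂ * x ^ 2 + 2 * W.b₄ * x + W.b₆) * x' =
        x ^ 4 - W.b₄ * x ^ 2 - 2 * W.b₆ * x - W.b₈ := by
  have e := (W.equation_iff x y).1 h.1
  have hy : y ≠ W.negY x y := fun hy ↦ h2 (by rw [two_nsmul, add_self_of_Y_eq hy])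
  refine ⟨_, _, _, (two_nsmul _).trans (add_self_of_Y_ne hy), ?_⟩
  rw [slope_of_Y_ne rfl hy, ← sq_sub_negY h.1]
  have hd : y - W.negY x y ≠ 0 := sub_ne_zero.2 hy
  obtain ⟨l, hl⟩ : ∃ l, l * (y - W.negY x y) = 3 * x ^ 2 + 2 * W.a₂ * x + W.a₄ - W.a₁ * y :=
    ⟨_, div_mul_cancel₀ _ hd⟩
  rw [← hl, mul_div_assoc, div_self hd, mul_one]
  simp only [addX, negY, b₄, b₆, b₈] at hl ⊢
  grind

end

variable {F : Type*} [Field F] {W : WeierstrassCurve.Affine F}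

/-- `P` is an affine point with `x`-coordinate `x`. -/
def HasX (P : W.Point) (x : F) : Prop :=
  ∃ (y : F) (h : W.Nonsingular x y), P = some x y h

theorem HasX.unique {P : W.Point} {x x' : F} (h : P.HasX x) (h' : P.HasX x') : x = x' := by
  obtain ⟨y, hy, rfl⟩ := h
  obtain ⟨y', hy', e⟩ := h'
  exact ((some.injEq ..).mp e).1

theorem HasX.ne_zero {P : W.Point} {x : F} (h : P.HasX x) : P ≠ 0 := by
  obtain ⟨y, hy, rfl⟩ := h
  exact some_ne_zero _

theorem HasX.eq_or_eq_neg {P Q : W.Point} {x : F} (h : P.HasX x) (h' : Q.HasX x) :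
    P = Q ∨ P = -Q := by
  obtain ⟨y, hy, rfl⟩ := h
  obtain ⟨y', hy', rfl⟩ := h'
  exact eq_or_eq_neg_of_X_eq hy hy'

theorem exists_hasX {P : W.Point} (h : P ≠ 0) : ∃ x, P.HasX x := by
  rcases P with _ | ⟨x, y, hy⟩
  · exact absurd rfl h
  · exact ⟨x, y, hy, rfl⟩

theorem exists_point_hasX [IsAlgClosed F] [W.IsElliptic] (x : F) : ∃ P : W.Point, P.HasX x := by
  obtain ⟨y, hy⟩ := IsAlgClosed.exists_root
    (Polynomial.X ^ 2 + Polynomial.C (W.a₁ * x + W.a₃) * Polynomial.X +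
      Polynomial.C (-(x ^ 3 + W.a₂ * x ^ 2 + W.a₄ * x + W.a₆)) : Polynomial F)
    (by
      have := Polynomial.degree_quadratic (a := (1 : F)) (b := W.a₁ * x + W.a₃)
        (c := -(x ^ 3 + W.a₂ * x ^ 2 + W.a₄ * x + W.a₆)) one_ne_zero
      rw [Polynomial.C_1, one_mul] at this
      rw [this]
      decide)
  have he : W.Equation x y := by
    rw [equation_iff]
    simp only [Polynomial.IsRoot.def, Polynomial.eval_add, Polynomial.eval_mul,
      Polynomial.eval_pow, Polynomial.eval_X, Polynomial.eval_C] at hy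
    linear_combination hy
  exact ⟨some x y ((W.equation_iff_nonsingular).1 he), y, _, rfl⟩

variable [DecidableEq F]

theorem HasX.two_nsmul {P : W.Point} {x : F} (h : P.HasX x) (h2 : 2 • P ≠ 0) :
    ∃ x', (2 • P).HasX x' ∧
      (4 * x ^ 3 + W.b₂ * x ^ 2 + 2 * W.b₄ * x + W.b₆) * x' =
        x ^ 4 - W.b₄ * x ^ 2 - 2 * W.b₆ * x - W.b₈ := by
  obtain ⟨y, hy, rfl⟩ := h
  obtain ⟨x', y', h', e, he⟩ := two_nsmul_eq_some hy h2
  exact ⟨x', ⟨y', h', e⟩, he⟩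

theorem HasX.two_nsmul_eq_zero_iff {P : W.Point} {x : F} (h : P.HasX x) :
    2 • P = 0 ↔ 4 * x ^ 3 + W.b₂ * x ^ 2 + 2 * W.b₄ * x + W.b₆ = 0 := by
  obtain ⟨y, hy, rfl⟩ := h
  exact Point.two_nsmul_eq_zero_iff hy

/-- The recursion for the `x`-coordinates of the multiples of `P`. -/
theorem HasX.add_two_nsmul {P : W.Point} {x x₀ x₁ : F} {m : ℕ} (h : P.HasX x)
    (h₀ : (m • P).HasX x₀) (h₁ : ((m + 1) • P).HasX x₁) (hx : x₁ ≠ x) :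
    ∃ x₂, ((m + 2) • P).HasX x₂ ∧
      (x₁ - x) ^ 2 * (x₂ + x₀) =
        2 * x₁ * x * (x₁ + x) + W.b₂ * (x₁ * x) + W.b₄ * (x₁ + x) + W.b₆ ∧
      (x₁ - x) ^ 2 * (x₂ * x₀) =
        x₁ ^ 2 * x ^ 2 - W.b₄ * (x₁ * x) - W.b₆ * (x₁ + x) - W.b₈ := by
  obtain ⟨y, hy, rfl⟩ := h
  obtain ⟨y₁, hy₁, e₁⟩ := h₁
  obtain ⟨x₂, y₂, h₂, x', y', h', hadd, hsub, hs, hp⟩ := add_sub_eq_some hy₁ hy hx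
  rw [← e₁, ← succ_nsmul] at hadd
  rw [← e₁, succ_nsmul, add_sub_cancel_right] at hsub
  obtain rfl := h₀.unique ⟨_, _, hsub⟩
  exact ⟨x₂, ⟨y₂, h₂, hadd⟩, hs, hp⟩

open Polynomial in
/-- Polynomials `A`, `B` such that, generically, the `x`-coordinate of `n • P` is `A(x) / B(x)`,
where `x` is the `x`-coordinate of `P`. -/
noncomputable def xFraction (W : WeierstrassCurve.Affine F) : ℕ → F[X] × F[X]
  | 0 => (1, 0)
  | 1 => (X, 1)
  | 2 => (X ^ 4 - C W.b₄ * X ^ 2 - 2 * C W.b₆ * X - C W.b₈,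
      4 * X ^ 3 + C W.b₂ * X ^ 2 + 2 * C W.b₄ * X + C W.b₆)
  | n + 3 =>
    let A := (xFraction W (n + 2)).1
    let B := (xFraction W (n + 2)).2
    let A₀ := (xFraction W (n + 1)).1
    let B₀ := (xFraction W (n + 1)).2
    ((2 * A * X * (A + X * B) + C W.b₂ * A * X * B + C W.b₄ * (A + X * B) * B +
      C W.b₆ * B ^ 2) * B₀ - A₀ * (A - X * B) ^ 2, (A - X * B) ^ 2 * B₀)

/-- The recursion divides by `(x(kP) - x(P))²`, whence the condition `kP ≠ ±P`. The fractions are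
not claimed to be reduced, so the nonvanishing of the denominator at `x` is carried through the
induction. -/
theorem HasX.xFraction_spec {P : W.Point} {x : F} (h : P.HasX x) (h2 : 2 • P ≠ 0) (m : ℕ)
    (hm : ∀ k, 2 ≤ k → k ≤ m → k • P ≠ P ∧ k • P ≠ -P) :
    ∀ k, 1 ≤ k → k ≤ m + 1 → ∃ x', (k • P).HasX x' ∧ (xFraction W k).2.eval x ≠ 0 ∧
      (xFraction W k).1.eval x = x' * (xFraction W k).2.eval x := by
  intro k
  induction k using Nat.strong_induction_on with
  | _ k ih =>
    intro hk1 hkm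
    match k with
    | 0 => omega
    | 1 => exact ⟨x, by simpa using h, by simp [xFraction], by simp [xFraction]⟩
    | 2 =>
      obtain ⟨x', hx', e⟩ := h.two_nsmul h2
      refine ⟨x', hx', ?_, ?_⟩
      · simpa [xFraction] using mt h.two_nsmul_eq_zero_iff.2 h2
      · simp [xFraction]
        linear_combination -e
    | n + 3 =>
      obtain ⟨x₁, hx₁, hB₁, hA₁⟩ := ih (n + 2) (by omega) (by omega) (by omega)
      obtain ⟨x₀, hx₀, hB₀, hA₀⟩ := ih (n + 1) (by omega) (by omega) (by omega)
      have hne : x₁ ≠ x := by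
        rintro rfl
        have := hm (n + 2) (by omega) (by omega)
        rcases hx₁.eq_or_eq_neg h with h | h <;> tauto
      obtain ⟨x₂, hx₂, hs, -⟩ := h.add_two_nsmul hx₀ hx₁ hne
      refine ⟨x₂, hx₂, ?_, ?_⟩
      · simp only [xFraction, Polynomial.eval_mul, Polynomial.eval_pow, Polynomial.eval_sub,
          Polynomial.eval_X, hA₁, ← sub_mul]
        exact mul_ne_zero (pow_ne_zero _ (mul_ne_zero (sub_ne_zero.2 hne) hB₁)) hB₀
      · simp only [xFraction, Polynomial.eval_mul, Polynomial.eval_pow, Polynomial.eval_sub,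
          Polynomial.eval_X, Polynomial.eval_add, Polynomial.eval_C, Polynomial.eval_ofNat,
          hA₁, hA₀]
        linear_combination -(Polynomial.eval x (xFraction W (n + 2)).2) ^ 2 *
          Polynomial.eval x (xFraction W (n + 1)).2 * hs

end WeierstrassCurve.Affine.Point

/-! ### Additive valuations of a nonarchimedean absolute value. -/

/-- The additive valuation of `x` attached to the absolute value `f` is `t` (so `x ≠ 0`). -/
def AbsoluteValue.Val {F : Type*} [Field F] (f : AbsoluteValue F ℝ) (x : F) (t : ℝ) : Prop :=
  f x = Real.exp (-t)

namespace AbsoluteValue.Val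

variable {F : Type*} [Field F] {f : AbsoluteValue F ℝ} {x y : F} {s t : ℝ}

theorem ne_zero (h : f.Val x t) : x ≠ 0 := by
  rintro rfl
  rw [AbsoluteValue.Val, map_zero] at h
  exact (Real.exp_pos _).ne h

theorem _root_.AbsoluteValue.exists_val (f : AbsoluteValue F ℝ) (hx : x ≠ 0) : ∃ t, f.Val x t :=
  ⟨-Real.log (f x), by rw [AbsoluteValue.Val, neg_neg, Real.exp_log (f.pos hx)]⟩

theorem unique (h : f.Val x s) (h' : f.Val x t) : s = t := by
  simpa using Real.exp_injective (h.symm.trans h')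

theorem mul (hx : f.Val x s) (hy : f.Val y t) : f.Val (x * y) (s + t) := by
  rw [AbsoluteValue.Val] at *
  rw [map_mul, hx, hy, ← Real.exp_add, neg_add]

theorem pow (hx : f.Val x s) (k : ℕ) : f.Val (x ^ k) (k * s) := by
  rw [AbsoluteValue.Val] at *
  rw [map_pow, hx, ← Real.exp_nat_mul, mul_neg]

theorem neg (hx : f.Val x s) : f.Val (-x) s := by
  rw [AbsoluteValue.Val] at *
  rw [map_neg_eq_map, hx]

theorem of_mul_left (h : f.Val (x * y) s) (hx : f.Val x t) : f.Val y (s - t) := by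
  have hy : y ≠ 0 := right_ne_zero_of_mul h.ne_zero
  obtain ⟨u, hu⟩ := f.exists_val hy
  rwa [h.unique (hx.mul hu), add_sub_cancel_left]

theorem one : f.Val 1 0 := by simp [AbsoluteValue.Val]

theorem of_pow {k : ℕ} (h : f.Val (x ^ k) s) (hk : k ≠ 0) : f.Val x (s / k) := by
  have hx : x ≠ 0 := fun h0 ↦ h.ne_zero (by simp [h0, hk])
  obtain ⟨u, hu⟩ := f.exists_val hx
  rwa [h.unique (hu.pow k), mul_div_cancel_left₀ _ (by exact_mod_cast hk)]

theorem add_of_lt (hf : IsNonarchimedean f) (hx : f.Val x s) (hy : f y < Real.exp (-s)) :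
    f.Val (x + y) s := by
  rw [AbsoluteValue.Val] at *
  rw [← hx] at hy ⊢
  rw [add_comm]
  exact hf.add_eq_right_of_lt hy

theorem add (hf : IsNonarchimedean f) (hx : f.Val x s) (hy : f.Val y t) (h : s < t) :
    f.Val (x + y) s :=
  hx.add_of_lt hf (by rw [hy]; exact Real.exp_lt_exp.2 (by linarith))

theorem sub (hf : IsNonarchimedean f) (hx : f.Val x s) (hy : f.Val y t) (h : s ≠ t) :
    f.Val (x - y) (min s t) := by
  rcases lt_or_gt_of_ne h with h | h
  · rw [min_eq_left h.le, sub_eq_add_neg]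
    exact hx.add hf hy.neg h
  · rw [min_eq_right h.le, ← neg_sub, sub_eq_add_neg]
    exact (hy.add hf hx.neg h).neg

theorem add' (hf : IsNonarchimedean f) (hx : f.Val x s) (hy : f.Val y t) (h : s ≠ t) :
    f.Val (x + y) (min s t) := by
  rw [← sub_neg_eq_add]
  exact hx.sub hf hy.neg h

theorem lt_one (hx : f.Val x s) (h : 0 < s) : f x < 1 := by
  rw [hx, Real.exp_lt_one_iff]
  linarith

end AbsoluteValue.Val

namespace AbsoluteValue

variable {F : Type*} [Field F] {f : AbsoluteValue F ℝ} {x y : F}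

theorem add_lt_one (hf : IsNonarchimedean f) (hx : f x < 1) (hy : f y < 1) : f (x + y) < 1 :=
  (hf x y).trans_lt (max_lt hx hy)

theorem natCast_mul_lt_one (hf : IsNonarchimedean f) (k : ℕ) (hx : f x < 1) :
    f (k * x) < 1 := by
  rw [map_mul]
  exact (mul_le_of_le_one_left (f.nonneg _) (hf.apply_natCast_le_one)).trans_lt hx

theorem mul_lt_one (hx : f x < 1) (hy : f y < 1) : f (x * y) < 1 := by
  rw [map_mul]
  exact mul_lt_one_of_nonneg_of_lt_one_left (f.nonneg _) hx hy.le

theorem val_mul_one_add (hf : IsNonarchimedean f) {s : ℝ} (hx : f.Val x s) (hy : f y < 1) :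
    f.Val (x * (1 + y)) s := by
  simpa using hx.mul (Val.one.add_of_lt hf (by simpa using hy))

end AbsoluteValue

/-! ### Valuations of multiples in a Tate-like coordinate. -/

namespace WeierstrassCurve.Affine

open Point

/-- In the coordinate `z = (x - r) / w`, the curve `W` has the `b`-invariants of
`y² + xy = x³ - 36δx - δ`. -/
structure IsTateCoordinate {F : Type*} [Field F] (W : WeierstrassCurve.Affine F) (r w δ : F) :
    Prop where
  ne_zero : w ≠ 0
  b₂_eq : W.b₂ + 12 * r = w
  b₄_eq : W.b₄ + r * W.b₂ + 6 * r ^ 2 = -72 * δ * w ^ 2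
  b₆_eq : W.b₆ + 2 * r * W.b₄ + r ^ 2 * W.b₂ + 4 * r ^ 3 = -4 * δ * w ^ 3
  b₈_eq : W.b₈ + 3 * r * W.b₆ + 3 * r ^ 2 * W.b₄ + r ^ 3 * W.b₂ + 3 * r ^ 4 =
    (-δ - 1296 * δ ^ 2) * w ^ 4

namespace IsTateCoordinate

variable {F : Type*} [Field F] {W : WeierstrassCurve.Affine F} {r w δ : F}

theorem exists_eq (h : W.IsTateCoordinate r w δ) (x : F) : ∃ z, x = w * z + r :=
  ⟨(x - r) / w, by rw [mul_div_cancel₀ _ h.ne_zero, sub_add_cancel]⟩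

theorem twoTorsion_eq (h : W.IsTateCoordinate r w δ) (z : F) :
    4 * (w * z + r) ^ 3 + W.b₂ * (w * z + r) ^ 2 + 2 * W.b₄ * (w * z + r) + W.b₆ =
      w ^ 3 * (4 * z ^ 3 + z ^ 2 - 144 * δ * z - 4 * δ) := by
  linear_combination w ^ 2 * z ^ 2 * h.b₂_eq + 2 * w * z * h.b₄_eq + h.b₆_eq

variable [DecidableEq F]

theorem two_nsmul (h : W.IsTateCoordinate r w δ) {P : W.Point} {z : F}
    (hP : P.HasX (w * z + r)) (h2 : 2 • P ≠ 0) :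
    ∃ z', (2 • P).HasX (w * z' + r) ∧
      (4 * z ^ 3 + z ^ 2 - 144 * δ * z - 4 * δ) * z' =
        z ^ 4 + 72 * δ * z ^ 2 + 8 * δ * z + δ + 1296 * δ ^ 2 := by
  obtain ⟨x', hx', e⟩ := hP.two_nsmul h2
  obtain ⟨z', rfl⟩ := h.exists_eq x'
  refine ⟨z', hx', mul_left_cancel₀ (pow_ne_zero 4 h.ne_zero) ?_⟩
  rw [h.twoTorsion_eq] at e
  linear_combination e + r * h.twoTorsion_eq z - w ^ 2 * z ^ 2 * h.b₄_eq - 2 * w * z * h.b₆_eq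
    - h.b₈_eq

theorem add_two_nsmul (h : W.IsTateCoordinate r w δ) {P : W.Point} {z z₀ z₁ : F} {m : ℕ}
    (hP : P.HasX (w * z + r)) (h₀ : (m • P).HasX (w * z₀ + r))
    (h₁ : ((m + 1) • P).HasX (w * z₁ + r)) (hz : z₁ ≠ z) :
    ∃ z₂, ((m + 2) • P).HasX (w * z₂ + r) ∧
      (z₁ - z) ^ 2 * (z₂ * z₀) =
        z₁ ^ 2 * z ^ 2 + 72 * δ * (z₁ * z) + 4 * δ * (z₁ + z) + δ + 1296 * δ ^ 2 := by
  obtain ⟨x₂, hx₂, hs, hp⟩ := hP.add_two_nsmul h₀ h₁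
    (fun e ↦ hz (mul_left_cancel₀ h.ne_zero (add_right_cancel e)))
  obtain ⟨z₂, rfl⟩ := h.exists_eq x₂
  refine ⟨z₂, hx₂, mul_left_cancel₀ (pow_ne_zero 4 h.ne_zero) ?_⟩
  linear_combination hp - r * hs - w ^ 2 * z₁ * z * h.b₄_eq - w * (z₁ + z) * h.b₆_eq - h.b₈_eq

variable {f : AbsoluteValue F ℝ} (hf : IsNonarchimedean f) {n : ℝ} (hδ : f.Val δ n) (hn : 0 < n)

include hf hδ hn

-- All terms but the first add up to `δ` times a unit `1 + ε` with `f ε < 1`, in any residue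
-- characteristic since integers have absolute value at most one. `hne` excludes a tie with the
-- first term.
omit [DecidableEq F] in
theorem val_num {z z₁ : F} {s t : ℝ} (hz₁ : f.Val z₁ s) (hz : f.Val z t) (hs : 0 < s) (ht : 0 < t)
    (hne : 2 * s + 2 * t ≠ n) :
    f.Val (z₁ ^ 2 * z ^ 2 + 72 * δ * (z₁ * z) + 4 * δ * (z₁ + z) + δ + 1296 * δ ^ 2)
      (min (2 * s + 2 * t) n) := by
  have h1 := hz₁.lt_one hs
  have h2 := hz.lt_one ht
  have h3 := hδ.lt_one hn
  have hd : f.Val (δ * (1 + ((72 : ℕ) * (z₁ * z) + (4 : ℕ) * (z₁ + z) + (1296 : ℕ) * δ))) n :=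
    AbsoluteValue.val_mul_one_add hf hδ <|
      AbsoluteValue.add_lt_one hf (AbsoluteValue.add_lt_one hf
        (AbsoluteValue.natCast_mul_lt_one hf _ (AbsoluteValue.mul_lt_one h1 h2))
        (AbsoluteValue.natCast_mul_lt_one hf _ (AbsoluteValue.add_lt_one hf h1 h2)))
        (AbsoluteValue.natCast_mul_lt_one hf _ h3)
  have := ((hz₁.pow 2).mul (hz.pow 2)).add' hf hd (by exact_mod_cast hne)
  push_cast at this
  convert this using 1
  ring

theorem val_two_nsmul (h : W.IsTateCoordinate r w δ) {P : W.Point} {z : F} {t : ℝ}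
    (hP : P.HasX (w * z + r)) (hz : f.Val z t) (ht : 0 < t) (htn : 2 * t < n) (hne : 4 * t ≠ n) :
    2 • P ≠ 0 ∧ ∃ z', (2 • P).HasX (w * z' + r) ∧ f.Val z' (min (4 * t) n - 2 * t) := by
  have h2 := hz.lt_one ht
  have h3 := hδ.lt_one hn
  -- As `2t < n`, the term `z²` dominates.
  have hden : f.Val (4 * z ^ 3 + z ^ 2 - 144 * δ * z - 4 * δ) (2 * t) := by
    have ha := AbsoluteValue.val_mul_one_add hf (hz.pow 2)
      (AbsoluteValue.natCast_mul_lt_one hf 4 h2)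
    have hb : f (δ * (-((144 : ℕ) * z + (4 : ℕ)))) < Real.exp (-((2 : ℕ) * t)) := by
      rw [map_mul, map_neg_eq_map]
      refine (mul_le_of_le_one_right (f.nonneg _) ((hf _ _).trans (max_le ?_ ?_))).trans_lt ?_
      · exact (AbsoluteValue.natCast_mul_lt_one hf _ h2).le
      · exact hf.apply_natCast_le_one
      · rw [hδ]
        exact Real.exp_lt_exp.2 (by push_cast; linarith)
    have := ha.add_of_lt hf hb
    push_cast at this
    convert this using 1
    ring
  have h2P : 2 • P ≠ 0 := fun h0 ↦ by
    rw [hP.two_nsmul_eq_zero_iff, h.twoTorsion_eq] at h0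
    exact mul_ne_zero (pow_ne_zero 3 h.ne_zero) hden.ne_zero h0
  obtain ⟨z', hz', e⟩ := h.two_nsmul hP h2P
  refine ⟨h2P, z', hz', ?_⟩
  have hnum := val_num hf hδ hn hz hz ht ht (by contrapose! hne; linarith)
  refine AbsoluteValue.Val.of_mul_left ?_ hden
  rw [e]
  convert hnum using 1 <;> ring_nf

/-- The product formula for `z(P₁ + P) z(P₁ - P)` suffices; `t < s` makes the valuation of `z₁ - z`
equal to `t`. -/
theorem val_add_two_nsmul (h : W.IsTateCoordinate r w δ) {P : W.Point} {z z₀ z₁ : F} {m : ℕ}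
    {s s₀ t : ℝ} (hP : P.HasX (w * z + r)) (h₀ : (m • P).HasX (w * z₀ + r))
    (h₁ : ((m + 1) • P).HasX (w * z₁ + r)) (hz : f.Val z t) (hz₀ : f.Val z₀ s₀)
    (hz₁ : f.Val z₁ s) (ht : 0 < t) (hs : 0 < s) (hst : t < s) (hne : 2 * s + 2 * t ≠ n) :
    ∃ z₂, ((m + 2) • P).HasX (w * z₂ + r) ∧
      f.Val z₂ (min (2 * s + 2 * t) n - 2 * t - s₀) := by
  obtain ⟨z₂, hz₂, e⟩ := h.add_two_nsmul hP h₀ h₁ (by rintro rfl; exact hst.ne (hz.unique hz₁))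
  refine ⟨z₂, hz₂, ?_⟩
  have hsub := (hz₁.sub hf hz hst.ne').pow 2
  rw [min_eq_right hst.le] at hsub
  have hnum := val_num hf hδ hn hz₁ hz hs ht hne
  rw [← e] at hnum
  have := hnum.of_mul_left hsub
  rw [mul_comm] at this
  convert this.of_mul_left hz₀ using 1
  norm_num

/-- The valuations of the multiples of a point `P` in the annulus around the first component of
the special fibre that contributes to the `p`-torsion, `p = 2 * q + 1`. -/
theorem val_nsmul (h : W.IsTateCoordinate r w δ) {P : W.Point} {z : F} {t : ℝ} {q : ℕ}
    (hP : P.HasX (w * z + r)) (hz : f.Val z t) (hq : 1 ≤ q) (h1 : n < (2 * q + 2) * t)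
    (h2 : 2 * q * t < n) :
    2 • P ≠ 0 ∧ ∀ m : ℕ, 1 ≤ m → m ≤ 2 * q →
      ∃ z', (m • P).HasX (w * z' + r) ∧ f.Val z' (min (m * t) (n - m * t)) := by
  have ht : 0 < t := by
    by_contra! h0
    nlinarith [mul_nonneg (by positivity : (0 : ℝ) ≤ 2 * q + 2) (neg_nonneg.2 h0)]
  -- The hypotheses place `n / 2` strictly between `q t` and `(q + 1) t`, so `mt = n - mt` never
  -- occurs; this rules out ties in the recursion.
  have hmid (m : ℕ) : 2 * (m * t) < n ∧ m ≤ q ∨ n < 2 * (m * t) ∧ q < m := by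
    rcases le_or_gt m q with hm | hm
    · have : (m : ℝ) ≤ q := by exact_mod_cast hm
      exact .inl ⟨by nlinarith, hm⟩
    · have : (q : ℝ) + 1 ≤ m := by exact_mod_cast hm
      exact .inr ⟨by nlinarith, hm⟩
  have hlt (m : ℕ) (hm : m ≤ 2 * q) : m * t < n := by
    have : (m : ℝ) ≤ 2 * q := by exact_mod_cast hm
    nlinarith
  have h21 : 2 * t < n := by
    rcases hmid 1 with h | h
    · simpa using h.1
    · omega
  have h22 : 4 * t ≠ n := by
    rcases hmid 2 with h | h <;> push_cast at h
    · linarith [h.1]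
    · intro h'; linarith [h.1]
  obtain ⟨h2P, z₂, hz₂, hv₂⟩ := val_two_nsmul hf hδ hn h hP hz ht h21 h22
  refine ⟨h2P, fun m ↦ ?_⟩
  induction m using Nat.strong_induction_on with
  | _ m ih =>
    intro hm1 hmq
    match m with
    | 0 => omega
    | 1 =>
      refine ⟨z, by simpa using hP, ?_⟩
      rw [min_eq_left (by push_cast; linarith)]
      simpa using hz
    | 2 =>
      refine ⟨z₂, hz₂, ?_⟩
      convert hv₂ using 1
      push_cast
      rw [← min_sub_sub_right]
      ring_nf
    | k + 3 =>
      obtain ⟨z₁, hz₁, hv₁⟩ := ih (k + 2) (by omega) (by omega) (by omega)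
      obtain ⟨z₀, hz₀, hv₀⟩ := ih (k + 1) (by omega) (by omega) (by omega)
      have l3 := hlt (k + 3) hmq
      have m1 := hmid (k + 1)
      have m2 := hmid (k + 2)
      have m3 := hmid (k + 3)
      have hk : 0 ≤ k * t := by positivity
      push_cast at *
      have hts : t < min ((k + 2) * t) (n - (k + 2) * t) := lt_min (by linarith) (by linarith)
      obtain ⟨z', hz', hv'⟩ := val_add_two_nsmul hf hδ hn h hP hz₀ hz₁ hz hv₀ hv₁ ht (ht.trans hts)
        hts (by
          rcases m2 with m2 | m2
          · rw [min_eq_left (by linarith)]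
            rcases m3 with m3 | m3
            · exact (by linarith [m3.1] : 2 * ((k + 2) * t) + 2 * t < n).ne
            · exact (by linarith [m3.1] : n < 2 * ((k + 2) * t) + 2 * t).ne'
          · rw [min_eq_right (by linarith)]
            rcases m1 with m1 | m1
            · exact (by linarith [m1.1] : n < 2 * (n - (k + 2) * t) + 2 * t).ne'
            · exact (by linarith [m1.1] : 2 * (n - (k + 2) * t) + 2 * t < n).ne)
      refine ⟨z', hz', ?_⟩
      convert hv' using 1
      rcases m1 with ⟨m1, -⟩ | ⟨m1, h1⟩ <;> rcases m2 with ⟨m2, h2⟩ | ⟨m2, h2⟩ <;>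
        rcases m3 with ⟨m3, h3⟩ | ⟨m3, h3⟩ <;> try omega
      all_goals grind
end IsTateCoordinate

end WeierstrassCurve.Affine

/-! ### Polynomials on annuli. -/

namespace AbsoluteValue

open Polynomial

variable {F : Type*} [Field F] {f : AbsoluteValue F ℝ} (hf : IsNonarchimedean f)

-- A factor `z - ρ` has valuation `v(ρ)` if `v(ρ) ≤ a`, and `t` if `ρ = 0` or `v(ρ) ≥ b`; thus `k`
-- counts the roots of the second kind.
include hf in
theorem exists_val_multiset_prod {a b : ℝ} (S : Multiset F)
    (hS : ∀ ρ ∈ S, ∀ t, f.Val ρ t → a < t → b ≤ t) :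
    ∃ C k : ℝ, ∀ z t, f.Val z t → a < t → t < b →
      f.Val (S.map fun ρ ↦ z - ρ).prod (C + k * t) := by
  induction S using Multiset.induction_on with
  | empty => exact ⟨0, 0, fun z t _ _ _ ↦ by simpa using Val.one⟩
  | cons ρ S ih =>
    obtain ⟨C, k, h⟩ := ih fun σ hσ ↦ hS σ (Multiset.mem_cons_of_mem hσ)
    have hρ := hS ρ (Multiset.mem_cons_self _ _)
    by_cases h0 : ρ = 0
    · refine ⟨C, 1 + k, fun z t hz ha hb ↦ ?_⟩
      rw [Multiset.map_cons, Multiset.prod_cons, h0, sub_zero]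
      convert hz.mul (h z t hz ha hb) using 1
      ring
    obtain ⟨s, hs⟩ := f.exists_val h0
    rcases le_or_gt s a with hsa | hsa
    · refine ⟨s + C, k, fun z t hz ha hb ↦ ?_⟩
      rw [Multiset.map_cons, Multiset.prod_cons]
      have := hz.sub hf hs (by linarith)
      rw [min_eq_right (by linarith)] at this
      convert this.mul (h z t hz ha hb) using 1
      ring
    · have hsb := hρ s hs hsa
      refine ⟨C, 1 + k, fun z t hz ha hb ↦ ?_⟩
      rw [Multiset.map_cons, Multiset.prod_cons]
      have := hz.sub hf hs (by linarith)
      rw [min_eq_left (by linarith)] at this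
      convert this.mul (h z t hz ha hb) using 1
      ring

variable [IsAlgClosed F]

include hf in
/-- On an annulus that contains no root, the valuation of a polynomial is an affine function. -/
theorem exists_val_eval {a b : ℝ} {p : F[X]} (hp : p ≠ 0)
    (h : ∀ z t, f.Val z t → a < t → t < b → p.eval z ≠ 0) :
    ∃ C k : ℝ, ∀ z t, f.Val z t → a < t → t < b → f.Val (p.eval z) (C + k * t) := by
  obtain ⟨C, k, hC⟩ := exists_val_multiset_prod hf (a := a) (b := b) p.roots
    fun ρ hρ t ht ha ↦ by
      by_contra! hb
      exact h ρ t ht ha hb ((mem_roots hp).1 hρ)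
  obtain ⟨u, hu⟩ := f.exists_val (leadingCoeff_ne_zero.2 hp)
  refine ⟨u + C, k, fun z t hz ha hb ↦ ?_⟩
  rw [(IsAlgClosed.splits p).eval_eq_prod_roots, add_assoc]
  exact hu.mul (hC z t hz ha hb)

/-- Roots of powers of `δ` have valuations `n s` with `s` rational, and these are dense. -/
theorem exists_val_mem_Ioo {δ : F} {n : ℝ} (hδ : f.Val δ n) (hn : 0 < n) {a b : ℝ} (ha : 0 ≤ a)
    (hab : a < b) : ∃ z t, f.Val z t ∧ a < t ∧ t < b := by
  obtain ⟨s, hs, hs'⟩ := exists_rat_btwn (div_lt_div_of_pos_right hab hn)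
  have h0 : 0 < s := by exact_mod_cast (div_nonneg ha hn.le).trans_lt hs
  obtain ⟨N, hN⟩ := Int.eq_ofNat_of_zero_le (Rat.num_pos.2 h0).le
  obtain ⟨z, hz⟩ := IsAlgClosed.exists_pow_nat_eq (δ ^ N) s.den_pos
  have hv := hδ.pow N
  rw [← hz] at hv
  have hst : (s : ℝ) = N / s.den := by
    rw [Rat.cast_def, hN]
    rfl
  rw [hst, div_lt_iff₀ hn] at hs
  rw [hst, lt_div_iff₀ hn] at hs'
  exact ⟨z, _, hv.of_pow s.den_pos.ne', by rwa [mul_div_right_comm],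
    by rwa [mul_div_right_comm]⟩

include hf in
/-- A break in the valuation of a rational function without poles is caused by a root. -/
theorem exists_root_of_break {δ : F} {n : ℝ} (hδ : f.Val δ n) (hn : 0 < n) {D G : F[X]}
    {a b c A₁ B₁ A₂ B₂ : ℝ} (ha : 0 ≤ a) (hac : a < c) (hcb : c < b) (hB : B₁ ≠ B₂)
    (hG : ∀ z t, f.Val z t → a < t → t < b → G.eval z ≠ 0)
    (h₁ : ∀ z t u, f.Val z t → a < t → t < c → f.Val (G.eval z) u →
      f.Val (D.eval z) (u + (A₁ + B₁ * t)))
    (h₂ : ∀ z t u, f.Val z t → c < t → t < b → f.Val (G.eval z) u →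
      f.Val (D.eval z) (u + (A₂ + B₂ * t))) :
    ∃ z, f.Val z c ∧ D.eval z = 0 := by
  by_contra! hD
  have hD' : ∀ z t, f.Val z t → a < t → t < b → D.eval z ≠ 0 := by
    intro z t hz hat htb
    obtain ⟨u, hu⟩ := f.exists_val (hG z t hz hat htb)
    rcases lt_trichotomy t c with h | rfl | h
    · exact (h₁ z t u hz hat h hu).ne_zero
    · exact hD z hz
    · exact (h₂ z t u hz h htb hu).ne_zero
  -- Without a root of `D`, both `D` and `G` have affine valuation on the whole annulus. Two sample
  -- points on each side of `c` show that the difference of their slopes is both `B₁` and `B₂`.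
  obtain ⟨m, ham, hmc⟩ := exists_between hac
  obtain ⟨m', hcm, hmb⟩ := exists_between hcb
  obtain ⟨z₁, t₁, hz₁, h1, h1'⟩ := exists_val_mem_Ioo hδ hn ha ham
  obtain ⟨z₂, t₂, hz₂, h2, h2'⟩ := exists_val_mem_Ioo hδ hn (ha.trans ham.le) hmc
  obtain ⟨z₃, t₃, hz₃, h3, h3'⟩ := exists_val_mem_Ioo hδ hn (ha.trans hac.le) hcm
  obtain ⟨z₄, t₄, hz₄, h4, h4'⟩ := exists_val_mem_Ioo hδ hn (ha.trans (hac.trans hcm).le) hmb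
  obtain ⟨C, k, hC⟩ := exists_val_eval hf (a := a) (b := b) (p := D)
    (fun h ↦ hD' z₁ t₁ hz₁ h1 (by linarith) (by simp [h])) hD'
  obtain ⟨C', k', hC'⟩ := exists_val_eval hf (a := a) (b := b) (p := G)
    (fun h ↦ hG z₁ t₁ hz₁ h1 (by linarith) (by simp [h])) hG
  have e₁ := (hC z₁ t₁ hz₁ (by linarith) (by linarith)).unique
    (h₁ z₁ t₁ _ hz₁ (by linarith) (by linarith) (hC' z₁ t₁ hz₁ (by linarith) (by linarith)))
  have e₂ := (hC z₂ t₂ hz₂ (by linarith) (by linarith)).unique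
    (h₁ z₂ t₂ _ hz₂ (by linarith) (by linarith) (hC' z₂ t₂ hz₂ (by linarith) (by linarith)))
  have e₃ := (hC z₃ t₃ hz₃ (by linarith) (by linarith)).unique
    (h₂ z₃ t₃ _ hz₃ (by linarith) (by linarith) (hC' z₃ t₃ hz₃ (by linarith) (by linarith)))
  have e₄ := (hC z₄ t₄ hz₄ (by linarith) (by linarith)).unique
    (h₂ z₄ t₄ _ hz₄ (by linarith) (by linarith) (hC' z₄ t₄ hz₄ (by linarith) (by linarith)))
  have s₁ : k - k' - B₁ = 0 :=
    (mul_eq_zero.1 (by linarith : (k - k' - B₁) * (t₂ - t₁) = 0)).resolve_right (by linarith)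
  have s₂ : k - k' - B₂ = 0 :=
    (mul_eq_zero.1 (by linarith : (k - k' - B₂) * (t₄ - t₃) = 0)).resolve_right (by linarith)
  exact hB (by linarith)

end AbsoluteValue

/-! ### Torsion points: finiteness and existence. -/

namespace WeierstrassCurve.Affine

open Point Polynomial

section

variable {F : Type*} [Field F] {W : WeierstrassCurve.Affine F}

theorem Point.HasX.neg {P : W.Point} {x : F} (h : P.HasX x) : (-P).HasX x := by
  obtain ⟨y, hy, rfl⟩ := h
  exact ⟨_, _, neg_some hy⟩

theorem Point.finite_setOf_hasX {S : Set F} (hS : S.Finite) :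
    {P : W.Point | ∃ x ∈ S, P.HasX x}.Finite := by
  have : {P : W.Point | ∃ x ∈ S, P.HasX x} = ⋃ x ∈ S, {P : W.Point | P.HasX x} := by
    ext P
    simp
  rw [this]
  refine hS.biUnion fun x _ ↦ ?_
  rcases Set.eq_empty_or_nonempty {P : W.Point | P.HasX x} with h | ⟨Q, hQ⟩
  · rw [h]
    exact Set.finite_empty
  · exact (Set.toFinite {Q, -Q}).subset fun P hP ↦ hP.eq_or_eq_neg hQ

end

variable {F : Type*} [Field F] [DecidableEq F] {W : WeierstrassCurve.Affine F}

theorem Point.eq_zero_of_nsmul_of_coprime {A : Type*} [AddGroup A] {P : A} {k m : ℕ}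
    (hk : k • P = 0) (hm : m • P = 0) (h : k.Coprime m) : P = 0 := by
  rw [← addOrderOf_dvd_iff_nsmul_eq_zero] at hk hm
  exact AddMonoid.addOrderOf_eq_one_iff.1 (Nat.eq_one_of_dvd_coprimes h hk hm)

theorem finite_two_torsion [CharZero F] : {P : W.Point | 2 • P = 0}.Finite := by
  let p : F[X] := C 4 * X ^ 3 + C W.b₂ * X ^ 2 + C (2 * W.b₄) * X + C W.b₆
  have hp : p ≠ 0 := by
    intro h
    have := degree_cubic (a := (4 : F)) (b := W.b₂) (c := 2 * W.b₄) (d := W.b₆) (by norm_num)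
    rw [show C 4 * X ^ 3 + C W.b₂ * X ^ 2 + C (2 * W.b₄) * X + C W.b₆ = p from rfl, h] at this
    simp at this
  refine ((Set.finite_singleton 0).union (finite_setOf_hasX (finite_setOfPred_isRoot hp))).subset ?_
  intro P hP
  by_cases h0 : P = 0
  · exact .inl h0
  · obtain ⟨x, hx⟩ := exists_hasX h0
    refine .inr ⟨x, ?_, hx⟩
    have := hx.two_nsmul_eq_zero_iff.1 hP
    simpa [p, IsRoot] using this

/-- The polynomial whose roots are the `x`-coordinates of the points `P` with `n • P = ± P`. -/
noncomputable def xFractionSub (W : WeierstrassCurve.Affine F) (n : ℕ) : F[X] :=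
  (xFraction W n).1 - X * (xFraction W n).2

/-- A nonzero `p`-torsion point has `(p - 1)P = -P`, so its `x` is a root of `xFractionSub W (p -
1)`; primality of `p` keeps the smaller multiples away from `±P`. -/
theorem finite_torsion_of_xFractionSub_ne_zero {p : ℕ} (hp : p.Prime) (hp2 : p ≠ 2)
    (h : xFractionSub W (p - 1) ≠ 0) : {P : W.Point | p • P = 0}.Finite := by
  have h2 := hp.two_le
  refine ((Set.finite_singleton 0).union
    (finite_setOf_hasX (finite_setOfPred_isRoot h))).subset ?_
  intro P hP
  by_cases h0 : P = 0
  · exact .inl h0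
  have hlt : ∀ k, 0 < k → k < p → k • P ≠ 0 := fun k hk hkp hP' ↦
    h0 (eq_zero_of_nsmul_of_coprime hP' hP
      ((Nat.coprime_of_lt_prime hk.ne' hkp hp).symm))
  obtain ⟨x, hx⟩ := exists_hasX h0
  refine .inr ⟨x, ?_, hx⟩
  have hne : ∀ k, 2 ≤ k → k ≤ p - 2 → k • P ≠ P ∧ k • P ≠ -P := by
    refine fun k hk hkp ↦ ⟨fun e ↦ hlt (k - 1) (by omega) (by omega) ?_,
      fun e ↦ hlt (k + 1) (by omega) (by omega) (by rw [succ_nsmul, e, neg_add_cancel])⟩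
    obtain ⟨j, rfl⟩ : ∃ j, k = j + 1 := ⟨k - 1, by omega⟩
    rw [succ_nsmul] at e
    simpa using e
  obtain ⟨x', hx', hB, hA⟩ := hx.xFraction_spec (hlt 2 (by omega) (by omega)) (p - 2) hne (p - 1)
    (by omega) (by omega)
  have hneg : (p - 1) • P = -P := by
    rw [eq_neg_iff_add_eq_zero, ← succ_nsmul, show p - 1 + 1 = p by omega]
    exact hP
  rw [hneg] at hx'
  obtain rfl := hx'.unique hx.neg
  simp [xFractionSub, hA]

namespace IsTateCoordinate

variable {r w δ : F} {f : AbsoluteValue F ℝ} (hf : IsNonarchimedean f) {n : ℝ}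
  (hδ : f.Val δ n) (hn : 0 < n)

include hf hδ hn in
theorem nsmul_spec (h : W.IsTateCoordinate r w δ) {P : W.Point} {z : F} {t : ℝ} {q : ℕ}
    (hP : P.HasX (w * z + r)) (hz : f.Val z t) (hq : 1 ≤ q) (h1 : n < (2 * q + 2) * t)
    (h2 : 2 * q * t < n) :
    ∃ z', ((2 * q) • P).HasX (w * z' + r) ∧ f.Val z' (n - 2 * q * t) ∧
      (xFraction W (2 * q)).2.eval (w * z + r) ≠ 0 ∧
      (xFractionSub W (2 * q)).eval (w * z + r) =
        (xFraction W (2 * q)).2.eval (w * z + r) * (w * (z' - z)) ∧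
      (2 * q - 1) • P ≠ 0 := by
  obtain ⟨h2P, H⟩ := h.val_nsmul hf hδ hn hP hz hq h1 h2
  -- For these `k` the valuation of `z(kP)` exceeds `t = v(z(P))`, so `kP ≠ ±P`.
  have key : ∀ k, 2 ≤ k → k ≤ 2 * q - 1 → ¬ (k • P).HasX (w * z + r) := by
    intro k hk hkq hX
    obtain ⟨z', hz', hv⟩ := H k (by omega) (by omega)
    obtain rfl : z' = z := mul_left_cancel₀ h.ne_zero (add_right_cancel (hz'.unique hX))
    have e := hv.unique hz
    have hk2 : (2 : ℝ) ≤ k := by exact_mod_cast hk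
    have hkq' : (k : ℝ) + 1 ≤ 2 * q := by exact_mod_cast (by omega : k + 1 ≤ 2 * q)
    have ht : 0 < t := by
      by_contra! h0
      nlinarith [mul_nonneg (by positivity : (0 : ℝ) ≤ 2 * q + 2) (neg_nonneg.2 h0)]
    exact (lt_min (by nlinarith : t < k * t) (by nlinarith : t < n - k * t)).ne' e
  obtain ⟨x', hx', hB, hA⟩ := hP.xFraction_spec h2P (2 * q - 1) (fun k hk hkq ↦
    ⟨fun e ↦ key k hk hkq (by rwa [e]), fun e ↦ key k hk hkq (by rw [e]; exact hP.neg)⟩) (2 * q) (by omega)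
    (by omega)
  obtain ⟨z', hz', hv⟩ := H (2 * q) (by omega) le_rfl
  obtain rfl := hx'.unique hz'
  obtain ⟨_, h', -⟩ := H (2 * q - 1) (by omega) (by omega)
  refine ⟨z', hz', ?_, hB, ?_, h'.ne_zero⟩
  · rw [min_eq_right] at hv
    · convert hv using 1
      push_cast
      ring
    · push_cast
      have : (1 : ℝ) ≤ q := by exact_mod_cast hq
      nlinarith
  · simp only [xFractionSub, eval_sub, eval_mul, eval_X, hA]
    ring

variable [IsAlgClosed F] [W.IsElliptic]

include hf hδ hn in
/-- For odd `p = 2 * q + 1` there is a `p`-torsion point on the first component. -/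
theorem exists_torsion_odd (h : W.IsTateCoordinate r w δ) {q : ℕ} (hq : 1 ≤ q) :
    xFractionSub W (2 * q) ≠ 0 ∧ ∃ (P : W.Point) (z : F), P.HasX (w * z + r) ∧
      f.Val z (n / (2 * q + 1)) ∧ (2 * q + 1) • P = 0 := by
  have hq1 : (1 : ℝ) ≤ q := by exact_mod_cast hq
  have hspec : ∀ z t, f.Val z t → n / (2 * q + 2) < t → t < n / (2 * q) → ∃ P : W.Point,
      P.HasX (w * z + r) ∧ ∃ z', ((2 * q) • P).HasX (w * z' + r) ∧ f.Val z' (n - 2 * q * t) ∧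
      (xFraction W (2 * q)).2.eval (w * z + r) ≠ 0 ∧
      (xFractionSub W (2 * q)).eval (w * z + r) =
        (xFraction W (2 * q)).2.eval (w * z + r) * (w * (z' - z)) ∧
      (2 * q - 1) • P ≠ 0 := by
    intro z t hz h1 h2
    rw [div_lt_iff₀' (by positivity)] at h1
    rw [lt_div_iff₀' (by positivity)] at h2
    obtain ⟨P, hP⟩ := exists_point_hasX (W := W) (w * z + r)
    exact ⟨P, hP, h.nsmul_spec hf hδ hn hP hz hq h1 h2⟩
  -- The break lies where `v(z(2qP)) = n - 2qt` equals `t`; the slopes on the two sides are `1` and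
  -- `-2q`.
  have hac : n / (2 * q + 2) < n / (2 * q + 1) := by gcongr; linarith
  have hcb : n / (2 * q + 1) < n / (2 * q) := by gcongr; linarith
  have ha : 0 ≤ n / (2 * q + 2) := by positivity
  obtain ⟨u, hu⟩ := f.exists_val h.ne_zero
  let G := (xFraction W (2 * q)).2.comp (C w * X + C r)
  let D := (xFractionSub W (2 * q)).comp (C w * X + C r)
  have hD₁ : ∀ z t v, f.Val z t → n / (2 * q + 2) < t → t < n / (2 * q + 1) →
      f.Val (G.eval z) v → f.Val (D.eval z) (v + (u + 1 * t)) := by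
    intro z t v hz h1 h2 hv
    obtain ⟨P, hP, z', hz', hv', hB, e, -⟩ := hspec z t hz h1 (h2.trans hcb)
    simp only [D, G, eval_comp, eval_add, eval_mul, eval_C, eval_X] at hv ⊢
    rw [lt_div_iff₀' (by positivity)] at h2
    have := hv'.sub hf hz (by linarith)
    rw [min_eq_right (by linarith)] at this
    rw [e, one_mul]
    exact hv.mul (hu.mul this)
  have hD₂ : ∀ z t v, f.Val z t → n / (2 * q + 1) < t → t < n / (2 * q) →
      f.Val (G.eval z) v → f.Val (D.eval z) (v + ((u + n) + (-(2 * q)) * t)) := by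
    intro z t v hz h1 h2 hv
    obtain ⟨P, hP, z', hz', hv', hB, e, -⟩ := hspec z t hz (hac.trans h1) h2
    simp only [D, G, eval_comp, eval_add, eval_mul, eval_C, eval_X] at hv ⊢
    rw [div_lt_iff₀' (by positivity)] at h1
    have := hv'.sub hf hz (by linarith)
    rw [min_eq_left (by linarith)] at this
    rw [e]
    convert hv.mul (hu.mul this) using 1
    ring
  have hG : ∀ z t, f.Val z t → n / (2 * q + 2) < t → t < n / (2 * q) → G.eval z ≠ 0 := by
    intro z t hz h1 h2
    obtain ⟨P, hP, z', hz', hv', hB, e, -⟩ := hspec z t hz h1 h2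
    simpa [G, eval_comp] using hB
  constructor
  · intro h0
    obtain ⟨z, t, hz, h1, h2⟩ := AbsoluteValue.exists_val_mem_Ioo hδ hn ha hac
    obtain ⟨v, hv⟩ := f.exists_val (hG z t hz h1 (h2.trans hcb))
    exact (hD₁ z t v hz h1 h2 hv).ne_zero (by simp [D, h0])
  · obtain ⟨z, hz, hDz⟩ := AbsoluteValue.exists_root_of_break hf hδ hn ha hac hcb
      (by linarith : (1 : ℝ) ≠ -(2 * q)) hG hD₁ hD₂
    obtain ⟨P, hP, z', hz', hv', hB, e, hP1⟩ := hspec z _ hz hac hcb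
    refine ⟨P, z, hP, hz, ?_⟩
    simp only [D, eval_comp, eval_add, eval_mul, eval_C, eval_X] at hDz
    rw [hDz] at e
    obtain rfl : z' = z := by
      simpa [hB, h.ne_zero, sub_eq_zero] using e.symm
    -- The sign `2qP = P` would give `(2q - 1)P = 0`, already excluded.
    rcases hz'.eq_or_eq_neg hP with e | e
    · obtain ⟨j, hj⟩ : ∃ j, 2 * q = j + 1 := ⟨2 * q - 1, by omega⟩
      rw [hj, succ_nsmul] at e
      rw [hj] at hP1
      exact absurd (by simpa using e) hP1
    · rw [succ_nsmul, e, neg_add_cancel]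

-- The 2-division cubic is `z²(1 + 4z) - 4δ(1 + 36z)`, whose valuation breaks where `2t = v(4δ)`.
-- The term `e = v(4)` is positive in residue characteristic 2.
include hf hδ hn in
theorem exists_torsion_two (h : W.IsTateCoordinate r w δ) {e : ℝ} (he : f.Val 4 e) :
    ∃ (P : W.Point) (z : F), P.HasX (w * z + r) ∧ f.Val z ((e + n) / 2) ∧ 2 • P = 0 := by
  have he0 : 0 ≤ e := by
    have : f 4 ≤ 1 := hf.apply_natCast_le_one (n := 4)
    rw [he, Real.exp_le_one_iff] at this
    linarith
  let D : F[X] := 4 * X ^ 3 + X ^ 2 - 144 * C δ * X - 4 * C δ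
  have hD : ∀ z t, f.Val z t → 0 < t → 2 * t ≠ e + n →
      f.Val (D.eval z) (min (2 * t) (e + n)) := by
    intro z t hz ht hne
    have hz1 := hz.lt_one ht
    have ha := AbsoluteValue.val_mul_one_add hf (hz.pow 2)
      (AbsoluteValue.natCast_mul_lt_one hf 4 hz1)
    have hb := AbsoluteValue.val_mul_one_add hf (he.mul hδ)
      (AbsoluteValue.natCast_mul_lt_one hf 36 hz1)
    have := ha.sub hf hb (by exact_mod_cast hne)
    push_cast at this
    convert this using 1
    simp [D]
    ring
  obtain ⟨z, hz, hDz⟩ := AbsoluteValue.exists_root_of_break hf hδ hn (D := D) (G := 1)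
    (a := 0) (b := e + n) (c := (e + n) / 2) (A₁ := 0) (B₁ := 2) (A₂ := e + n) (B₂ := 0)
    le_rfl (by linarith) (by linarith) (by norm_num) (fun z t _ _ _ ↦ by simp)
    (fun z t u hz h1 h2 hu ↦ by
      rw [eval_one] at hu
      have := hD z t hz h1 (by linarith)
      rw [min_eq_left (by linarith)] at this
      rwa [hu.unique AbsoluteValue.Val.one, zero_add, zero_add])
    (fun z t u hz h1 h2 hu ↦ by
      rw [eval_one] at hu
      have := hD z t hz (by linarith) (by linarith)
      rw [min_eq_right (by linarith)] at this
      rwa [hu.unique AbsoluteValue.Val.one, zero_add, zero_mul, add_zero])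
  obtain ⟨P, hP⟩ := exists_point_hasX (W := W) (w * z + r)
  refine ⟨P, z, hP, hz, ?_⟩
  rw [hP.two_nsmul_eq_zero_iff, h.twoTorsion_eq]
  simp [D] at hDz
  rw [hDz, mul_zero]

end IsTateCoordinate

end WeierstrassCurve.Affine

namespace WeierstrassCurve.Affine

/-- A curve with `c₄`, `c₆` nonzero is a twist of `y² + xy = x³ - 36δx - δ`, where
`δ = Δ / c₆²`. -/
theorem isTateCoordinate {F : Type*} [Field F] [CharZero F] (W : WeierstrassCurve.Affine F)
    (h₄ : W.c₄ ≠ 0) (h₆ : W.c₆ ≠ 0) :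
    W.IsTateCoordinate ((-W.c₆ / W.c₄ - W.b₂) / 12) (-W.c₆ / W.c₄) (W.Δ / W.c₆ ^ 2) := by
  have hw : -W.c₆ / W.c₄ ≠ 0 := div_ne_zero (neg_ne_zero.2 h₆) h₄
  have hΔ := W.c_relation
  obtain ⟨w, hw'⟩ : ∃ w, w = -W.c₆ / W.c₄ := ⟨_, rfl⟩
  have hc : w * W.c₄ = -W.c₆ := by rw [hw', div_mul_cancel₀ _ h₄]
  obtain ⟨d, hd'⟩ : ∃ d, d = W.Δ / W.c₆ ^ 2 := ⟨_, rfl⟩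
  have hd : d * W.c₆ ^ 2 = W.Δ := by rw [hd', div_mul_cancel₀ _ (pow_ne_zero 2 h₆)]
  rw [← hw'] at hw ⊢
  rw [← hd']
  -- `1728 δ w² = c₄ - w²`
  have key : 1728 * d * w ^ 2 = W.c₄ - w ^ 2 := by
    apply mul_right_cancel₀ (pow_ne_zero 2 h₄)
    have : W.c₆ = -(w * W.c₄) := by rw [hc, neg_neg]
    rw [this] at hd hΔ
    linear_combination 1728 * hd + hΔ
  obtain ⟨r, hr'⟩ : ∃ r, r = (w - W.b₂) / 12 := ⟨_, rfl⟩
  have hr : W.b₂ = w - 12 * r := by rw [hr']; field_simp; ring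
  rw [← hr']
  have hc6 : W.c₆ = -(w * W.c₄) := by rw [hc, neg_neg]
  -- In characteristic zero `b₂`, `c₄`, `c₆` determine `b₄` and `b₆`, and then `b₈`.
  have e4 : 24 * W.b₄ = W.b₂ ^ 2 - W.c₄ := by rw [c₄]; ring
  have e6 : 216 * W.b₆ = -W.b₂ ^ 3 + 36 * W.b₂ * W.b₄ - W.c₆ := by rw [c₆]; ring
  have e8 := W.b_relation
  have hb4 : W.b₄ + r * W.b₂ + 6 * r ^ 2 = -72 * d * w ^ 2 := by
    apply mul_left_cancel₀ (by norm_num : (24 : F) ≠ 0)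
    rw [hr] at e4 ⊢
    linear_combination e4 + key
  have hb6 : W.b₆ + 2 * r * W.b₄ + r ^ 2 * W.b₂ + 4 * r ^ 3 = -4 * d * w ^ 3 := by
    apply mul_left_cancel₀ (by norm_num : (216 : F) ≠ 0)
    rw [hc6, hr] at e6
    rw [hr] at hb4 ⊢
    linear_combination e6 + 36 * w * hb4 - w * key
  refine ⟨hw, by rw [hr]; ring, hb4, hb6, ?_⟩
  apply mul_left_cancel₀ (by norm_num : (4 : F) ≠ 0)
  rw [hr] at hb4 hb6 e8 ⊢
  linear_combination e8 + w * hb6 -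
    (W.b₄ + r * (w - 12 * r) + 6 * r ^ 2 - 72 * d * w ^ 2) * hb4

end WeierstrassCurve.Affine

/-! ### Absolute values of `K̄` above `𝔮` and their centres. -/

noncomputable section

namespace EllipticGalois

open NumberField.HeightOneSpectrum

section

open scoped Valued

/-- The `𝔮`-adic absolute value extends to a nonarchimedean absolute value of `K̄`. -/
theorem exists_absoluteValue {K : Type*} [Field K] [NumberField K]
    (𝔮 : IsDedekindDomain.HeightOneSpectrum (𝓞 K)) :
    ∃ f : AbsoluteValue (AlgebraicClosure K) ℝ, IsNonarchimedean f ∧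
      ∀ x : K, f (algebraMap K _ x) = adicAbv K 𝔮 x := by
  let Kq := 𝔮.adicCompletion K
  let C := AlgebraicClosure Kq
  let _ : Algebra K C := ((algebraMap Kq C).comp (NumberField.FinitePlace.embedding 𝔮)).toAlgebra
  let φ : AlgebraicClosure K →ₐ[K] C := IsAlgClosed.lift
  let g : MulAlgebraNorm Kq C := spectralMulAlgNorm Kq C
  let f : AbsoluteValue (AlgebraicClosure K) ℝ :=
    { toFun := fun x ↦ g (φ x)
      map_mul' := fun x y ↦ by rw [map_mul, map_mul]
      nonneg' := fun x ↦ apply_nonneg g _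
      eq_zero' := fun x ↦ by
        rw [map_eq_zero_iff_eq_zero, map_eq_zero]
      add_le' := fun x y ↦ by rw [map_add]; exact map_add_le_add g _ _ }
  refine ⟨f, fun x y ↦ ?_, fun x ↦ ?_⟩
  · change g (φ (x + y)) ≤ max (g (φ x)) (g (φ y))
    rw [map_add]
    exact isNonarchimedean_spectralNorm _ _
  · change g (φ (algebraMap K _ x)) = _
    rw [AlgHom.commutes]
    exact (spectralNorm_extends _).trans (NumberField.FinitePlace.norm_embedding 𝔮 x)

end

section Center

variable {K : Type*} [Field K] [NumberField K] {𝔮 : IsDedekindDomain.HeightOneSpectrum (𝓞 K)}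
  {f : AbsoluteValue (AlgebraicClosure K) ℝ}

/-- If `f α > 1`, the leading term of a monic integral equation for `α` would strictly dominate the
others. -/
theorem apply_intBar_le_one (hf : IsNonarchimedean f)
    (hfK : ∀ x : K, f (algebraMap K _ x) = adicAbv K 𝔮 x) (α : IntBar K) : f α ≤ 1 := by
  obtain ⟨p, hp, hpα⟩ := α.2
  by_contra! h
  have hle : ∀ i, f (algebraMap (𝓞 K) (AlgebraicClosure K) (p.coeff i)) ≤ 1 := fun i ↦ by
    rw [IsScalarTower.algebraMap_apply (𝓞 K) K, hfK]
    exact 𝔮.adicAbv_coe_le_one (one_lt_absNorm_nnreal 𝔮) _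
  have hd : p.natDegree ≠ 0 := by
    intro h0
    rw [hp.natDegree_eq_zero.1 h0] at hpα
    simp at hpα
  rw [Polynomial.eval₂_eq_sum_range, Finset.sum_range_succ, hp.coeff_natDegree, map_one,
    one_mul] at hpα
  have hlt : f (∑ i ∈ Finset.range p.natDegree,
      algebraMap (𝓞 K) (AlgebraicClosure K) (p.coeff i) * (α : AlgebraicClosure K) ^ i) <
      f ((α : AlgebraicClosure K) ^ p.natDegree) := by
    obtain ⟨i, hi, hle'⟩ := hf.finset_image_add_of_nonempty (t := Finset.range p.natDegree)
      (fun i ↦ algebraMap (𝓞 K) (AlgebraicClosure K) (p.coeff i) * (α : AlgebraicClosure K) ^ i)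
      (by simpa using hd)
    refine hle'.trans_lt ?_
    rw [map_mul, map_pow, map_pow]
    calc _ ≤ 1 * f α ^ i := by gcongr; exact hle i
      _ < _ := by rw [one_mul]; exact pow_lt_pow_right₀ h (Finset.mem_range.1 hi)
  rw [eq_neg_of_add_eq_zero_left hpα, map_neg_eq_map] at hlt
  exact lt_irrefl _ hlt

/-- The centre on the ring of algebraic integers of an absolute value extending the `𝔮`-adic
one. -/
def center (hf : IsNonarchimedean f) (hfK : ∀ x : K, f (algebraMap K _ x) = adicAbv K 𝔮 x) :
    Ideal (IntBar K) where
  carrier := {α | f α < 1}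
  add_mem' {a b} ha hb := AbsoluteValue.add_lt_one hf ha hb
  zero_mem' := by simp
  smul_mem' a b hb := by
    change f (a * b : AlgebraicClosure K) < 1
    rw [map_mul]
    exact (mul_le_of_le_one_left (f.nonneg _) (apply_intBar_le_one hf hfK a)).trans_lt hb

theorem mem_center (hf : IsNonarchimedean f)
    (hfK : ∀ x : K, f (algebraMap K _ x) = adicAbv K 𝔮 x) {α : IntBar K} :
    α ∈ center hf hfK ↔ f α < 1 := Iff.rfl

instance (hf : IsNonarchimedean f) (hfK : ∀ x : K, f (algebraMap K _ x) = adicAbv K 𝔮 x) :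
    (center hf hfK).IsPrime where
  ne_top' := by
    rw [Ideal.ne_top_iff_one, mem_center]
    simp
  mem_or_mem' {a b} h := by
    by_contra! h'
    simp only [mem_center, not_lt] at h h'
    have : f ((a * b : IntBar K) : AlgebraicClosure K) = f a * f b := map_mul f _ _
    nlinarith [h'.1, h'.2]

theorem under_center (hf : IsNonarchimedean f)
    (hfK : ∀ x : K, f (algebraMap K _ x) = adicAbv K 𝔮 x) :
    (center hf hfK).under (𝓞 K) = 𝔮.asIdeal := by
  ext x
  rw [Ideal.under_def, Ideal.mem_comap, mem_center]
  change f (algebraMap (𝓞 K) (AlgebraicClosure K) x) < 1 ↔ _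
  rw [IsScalarTower.algebraMap_apply (𝓞 K) K, hfK]
  exact 𝔮.adicAbv_coe_lt_one_iff (one_lt_absNorm_nnreal 𝔮) x

section Profinite

open scoped Pointwise

local instance : TopologicalSpace (IntBar K) := ⊥

local instance : DiscreteTopology (IntBar K) := ⟨rfl⟩

/-- With `isInvariant_intBar`, this makes the profinite theorem on transitivity on primes available.
-/
theorem continuousSMul_intBar (F : Type*) [Field F] :
    ContinuousSMul (AbsGal F) (IntBar F) := by
  rw [continuousSMul_iff_stabilizer_isOpen]
  intro x
  convert stabilizer_isOpen_of_isIntegral (K := F) (x : AlgebraicClosure F) using 1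
  ext σ
  exact Subtype.ext_iff

theorem isInvariant_intBar : Algebra.IsInvariant (𝓞 K) (IntBar K) (AbsGal K) where
  isInvariant b hb := by
    have h : (b : AlgebraicClosure K) ∈ (⊥ : IntermediateField K (AlgebraicClosure K)) := by
      rw [← InfiniteGalois.fixedField_fixingSubgroup (⊥ : IntermediateField K (AlgebraicClosure K))]
      exact fun σ ↦ congrArg Subtype.val (hb σ.1)
    obtain ⟨x, hx⟩ := IntermediateField.mem_bot.1 h
    have hi : IsIntegral (𝓞 K) x := by
      rw [← isIntegral_algebraMap_iff (algebraMap K (AlgebraicClosure K)).injective, hx]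
      exact b.2
    obtain ⟨y, rfl⟩ := IsIntegrallyClosed.algebraMap_eq_of_integral hi
    refine ⟨y, Subtype.ext ?_⟩
    rw [← hx]
    exact IsScalarTower.algebraMap_apply (𝓞 K) K (AlgebraicClosure K) y

/-- Every prime above `𝔮` is the centre of an absolute value extending the `𝔮`-adic one. -/
theorem exists_absoluteValue_center (𝔓 : Ideal (IntBar K)) [𝔓.IsPrime]
    [𝔓.LiesOver 𝔮.asIdeal] :
    ∃ f : AbsoluteValue (AlgebraicClosure K) ℝ, IsNonarchimedean f ∧
      (∀ x : K, f (algebraMap K _ x) = adicAbv K 𝔮 x) ∧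
      (∀ α : IntBar K, f α ≤ 1) ∧ ∀ α : IntBar K, α ∈ 𝔓 ↔ f α < 1 := by
  obtain ⟨f, hf, hfK⟩ := exists_absoluteValue 𝔮
  have := continuousSMul_intBar K
  have := isInvariant_intBar (K := K)
  -- The Galois group permutes the primes above `𝔮` transitively, so composing `f` with a suitable
  -- `σ` moves its centre to `𝔓`.
  obtain ⟨σ, hσ⟩ := Algebra.IsInvariant.exists_smul_of_under_eq_of_profinite (A := 𝓞 K)
    (G := AbsGal K) 𝔓 (center hf hfK) (by rw [under_center, ← Ideal.over_def 𝔓 𝔮.asIdeal])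
  let g : AbsoluteValue (AlgebraicClosure K) ℝ :=
    f.comp (f := (σ : AlgebraicClosure K →+* AlgebraicClosure K)) σ.injective
  have hg : IsNonarchimedean g := fun x y ↦ by
    change f (σ (x + y)) ≤ max (f (σ x)) (f (σ y))
    rw [map_add]
    exact hf _ _
  have hgK : ∀ x : K, g (algebraMap K _ x) = adicAbv K 𝔮 x := fun x ↦ by
    change f (σ (algebraMap K _ x)) = _
    rw [AlgEquiv.commutes, hfK]
  refine ⟨g, hg, hgK, apply_intBar_le_one hg hgK, fun α ↦ ?_⟩
  rw [← Ideal.smul_mem_pointwise_smul_iff (a := σ), ← hσ, mem_center]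
  rfl

end Profinite

end Center

/-! ### Surjectivity of inertia onto finite quotients. -/

section InertiaSurjective

open scoped Pointwise

variable {K : Type*} [Field K] [NumberField K]

/-- The inclusion of the ring of integers of a subfield of `K̄` in the ring of all algebraic
integers. -/
def ringOfIntegersToIntBar (L : IntermediateField K (AlgebraicClosure K)) : 𝓞 L →+* IntBar K where
  toFun x := ⟨algebraMap L (AlgebraicClosure K) x,
    ((NumberField.RingOfIntegers.isIntegral_coe x).algebraMap
      (B := AlgebraicClosure K)).tower_top⟩
  map_one' := rfl
  map_mul' _ _ := rfl
  map_zero' := rfl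
  map_add' _ _ := rfl

variable (L : IntermediateField K (AlgebraicClosure K))

/-- `IntBar K` as an algebra over the ring of integers of a subfield of `K̄`. -/
abbrev intBarAlgebra : Algebra (𝓞 L) (IntBar K) := (ringOfIntegersToIntBar L).toAlgebra

attribute [local instance] intBarAlgebra

local instance : TopologicalSpace (IntBar K) := ⊥

local instance : DiscreteTopology (IntBar K) := ⟨rfl⟩

omit [NumberField K] in
theorem smulCommClass_fixingSubgroup : SMulCommClass L.fixingSubgroup (𝓞 L) (IntBar K) where
  smul_comm n a b := by
    refine Subtype.ext ?_
    change n.1 ((a : L) * (b : AlgebraicClosure K)) = (a : L) * n.1 b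
    rw [map_mul]
    exact congrArg (· * _) (n.2 (a : L))

theorem isInvariant_fixingSubgroup :
    Algebra.IsInvariant (𝓞 L) (IntBar K) L.fixingSubgroup where
  isInvariant b hb := by
    have h : (b : AlgebraicClosure K) ∈ L := by
      rw [← InfiniteGalois.fixedField_fixingSubgroup L]
      exact fun σ ↦ congrArg Subtype.val (hb σ)
    have hb' : IsIntegral ℤ (b : AlgebraicClosure K) := isIntegral_trans (A := 𝓞 K) _ b.2
    have hi : IsIntegral ℤ (⟨b, h⟩ : L) :=
      (isIntegral_algebraMap_iff (algebraMap L (AlgebraicClosure K)).injective).1 hb'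
    exact ⟨⟨⟨b, h⟩, hi⟩, rfl⟩

set_option synthInstance.maxHeartbeats 200000 in
/-- The inertia group of `Gal(K̄/K)` at `𝔓` surjects onto the inertia group of `Gal(L/K)` at the
prime below `𝔓`. -/
theorem exists_inertia_restrictNormalHom_eq [FiniteDimensional K L] [Normal K L]
    (𝔓 : Ideal (IntBar K)) [𝔓.IsPrime]
    {τ : L ≃ₐ[K] L}
    (hτ : τ ∈ (𝔓.comap (ringOfIntegersToIntBar L)).inertia (L ≃ₐ[K] L)) :
    ∃ σ ∈ inertiaSubgroup 𝔓, AlgEquiv.restrictNormalHom L σ = τ := by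
  let N := L.fixingSubgroup
  have := smulCommClass_fixingSubgroup L
  have := isInvariant_fixingSubgroup L
  have := continuousSMul_intBar K
  have : ContinuousSMul N (IntBar K) :=
    ⟨(continuous_smul (M := AbsGal K) (X := IntBar K)).comp
      (continuous_subtype_val.prodMap continuous_id)⟩
  have : CompactSpace N := isCompact_iff_compactSpace.1
    (IntermediateField.fixingSubgroup_isClosed L).isCompact
  let 𝔭 : Ideal (𝓞 L) := 𝔓.under (𝓞 L)
  have hN : ∀ n : N, AlgEquiv.restrictNormalHom L n.1 = 1 := fun n ↦ by
    ext x
    exact (AlgEquiv.restrictNormal_commutes n.1 L x).trans (n.2 x)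
  have hsmul : ∀ (σ : AbsGal K) (x : 𝓞 L), σ • algebraMap (𝓞 L) (IntBar K) x =
      algebraMap (𝓞 L) (IntBar K) (AlgEquiv.restrictNormalHom L σ • x) := fun σ x ↦
    Subtype.ext (AlgEquiv.restrictNormal_commutes σ L (x : L)).symm
  -- An arbitrary lift of `τ` is corrected twice by elements of `N = Gal(K̄/L)`, which do not change
  -- the restriction to `L`: by `g` so that it stabilises `𝔓`, then by `n` so that it acts trivially
  -- modulo `𝔓`.
  obtain ⟨σ₁, hσ₁⟩ := AlgEquiv.restrictNormalHom_surjective (F := K) (K₁ := L)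
    (AlgebraicClosure K) τ
  have hstab : ∀ x : 𝓞 L, τ⁻¹ • x ∈ 𝔭 ↔ x ∈ 𝔭 := fun x ↦ by
    have h := (𝔓.comap (ringOfIntegersToIntBar L)).inertia_le_stabilizer (M := L ≃ₐ[K] L)
      (inv_mem hτ)
    rw [MulAction.mem_stabilizer_iff] at h
    conv_lhs => rw [show 𝔭 = τ⁻¹ • 𝔭 from h.symm]
    exact Ideal.smul_mem_pointwise_smul_iff
  obtain ⟨g, hg⟩ := Algebra.IsInvariant.exists_smul_of_under_eq_of_profinite (A := 𝓞 L)
    (G := N) (σ₁ • 𝔓) 𝔓 (by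
      ext x
      rw [Ideal.under_def, Ideal.mem_comap, Ideal.mem_pointwise_smul_iff_inv_smul_mem, hsmul,
        map_inv, hσ₁]
      exact hstab x)
  let σ₂ : AbsGal K := g.1 * σ₁
  have hσ₂ : σ₂ • 𝔓 = 𝔓 := by
    rw [mul_smul]
    exact hg.symm
  have hτ₂ : AlgEquiv.restrictNormalHom L σ₂ = τ := by rw [map_mul, hN, one_mul, hσ₁]
  let e₀ : (IntBar K ⧸ 𝔓) ≃+* (IntBar K ⧸ 𝔓) :=
    Ideal.quotientEquiv 𝔓 𝔓 (MulSemiringAction.toRingEquiv (AbsGal K) (IntBar K) σ₂) hσ₂.symm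
  have : 𝔓.LiesOver 𝔭 := ⟨rfl⟩
  -- Linearity over `𝓞 L ⧸ 𝔭` is where `τ` being inertial enters.
  let e : (IntBar K ⧸ 𝔓) ≃ₐ[𝓞 L ⧸ 𝔭] (IntBar K ⧸ 𝔓) := AlgEquiv.ofRingEquiv (f := e₀) (by
    intro x
    obtain ⟨x, rfl⟩ := Ideal.Quotient.mk_surjective x
    change Ideal.Quotient.mk 𝔓 (σ₂ • algebraMap (𝓞 L) (IntBar K) x) =
      Ideal.Quotient.mk 𝔓 (algebraMap (𝓞 L) (IntBar K) x)
    rw [hsmul, hτ₂, Ideal.Quotient.eq, ← map_sub]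
    exact hτ x)
  obtain ⟨n, hn⟩ := Ideal.Quotient.stabilizerHom_surjective_of_profinite (G := N) 𝔭 𝔓 e
  refine ⟨n.1.1⁻¹ * σ₂, fun x ↦ ?_, by rw [map_mul, map_inv, hN, inv_one, one_mul, hτ₂]⟩
  have h : Ideal.Quotient.mk 𝔓 (n.1.1 • x) = Ideal.Quotient.mk 𝔓 (σ₂ • x) :=
    DFunLike.congr_fun hn (Ideal.Quotient.mk 𝔓 x)
  have hn𝔓 : n.1.1 • 𝔓 = 𝔓 := n.2
  change (n.1.1⁻¹ * σ₂) • x - x ∈ 𝔓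
  rw [← Ideal.smul_mem_pointwise_smul_iff (a := n.1.1), hn𝔓, smul_sub, ← mul_smul,
    mul_inv_cancel_left]
  exact Ideal.Quotient.eq.1 h.symm

end InertiaSurjective

/-! ### Ramification forced by a fractional valuation. -/

section Ramification

open IsDedekindDomain

/-- An absolute value with centre `w` on a Dedekind domain has the same units as the `w`-adic
valuation. -/
theorem valuation_eq_one_of_absoluteValue_eq_one {R L : Type*} [CommRing R] [IsDedekindDomain R]
    [Field L] [Algebra R L] [IsFractionRing R L] (w : HeightOneSpectrum R) {g : AbsoluteValue L ℝ}
    (hle : ∀ x : R, g (algebraMap R L x) ≤ 1)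
    (hlt : ∀ x : R, x ∈ w.asIdeal ↔ g (algebraMap R L x) < 1) {y : L} (hy : g y = 1) :
    w.valuation L y = 1 := by
  have key : ∀ x : R, g (algebraMap R L x) = 1 ↔ w.valuation L (algebraMap R L x) = 1 := fun x ↦ by
    rw [HeightOneSpectrum.valuation_of_algebraMap,
      HeightOneSpectrum.intValuation_eq_one_iff_mem_primeCompl, Ideal.mem_primeCompl_iff, hlt,
      not_lt]
    exact ⟨fun h ↦ h.ge, fun h ↦ (hle x).antisymm h⟩
  -- Writing `y` or its inverse with a denominator outside `w` reduces to integral elements, where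
  -- being a unit means lying outside the prime for both valuations.
  obtain ⟨n, d, h⟩ := w.exists_primeCompl_mul_eq_or_mul_eq y
  have hd : w.valuation L (algebraMap R L d) = 1 := by
    rw [HeightOneSpectrum.valuation_of_algebraMap,
      HeightOneSpectrum.intValuation_eq_one_iff_mem_primeCompl]
    exact d.2
  have hd' := (key d).2 hd
  rcases h with h | h
  · have hn : g (algebraMap R L n) = 1 := by rw [← h, map_mul, hy, hd', one_mul]
    rw [key, ← h, map_mul, hd, mul_one] at hn
    exact hn
  · rw [← h, map_mul, hy, one_mul, key] at hd'
    rw [← h, map_mul, hd', mul_one] at hd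
    exact hd

variable {K : Type*} [Field K] [NumberField K] {𝔮 : HeightOneSpectrum (𝓞 K)}

/-- If a field `L` contains an element `z` such that `z ^ p / c` is a unit at `𝔓`, where `c ∈ K`
and `p` does not divide `ord_𝔮 c`, then `p` divides the order of the inertia group of `L / K`
at the prime below `𝔓`. -/
theorem dvd_card_inertia {f : AbsoluteValue (AlgebraicClosure K) ℝ}
    (𝔓 : Ideal (IntBar K)) [𝔓.IsPrime] [𝔓.LiesOver 𝔮.asIdeal]
    (hle : ∀ α : IntBar K, f α ≤ 1) (hlt : ∀ α : IntBar K, α ∈ 𝔓 ↔ f α < 1)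
    (L : IntermediateField K (AlgebraicClosure K)) [FiniteDimensional K L] [IsGalois K L]
    {p : ℕ} (hp : p.Prime) {c : K} (hc : c ≠ 0) (hpc : ¬ (p : ℤ) ∣ ord 𝔮 c)
    {z : AlgebraicClosure K} (hz : z ∈ L) (hzc : f z ^ p = f (algebraMap K _ c)) :
    p ∣ Nat.card ((𝔓.comap (ringOfIntegersToIntBar L)).inertia (L ≃ₐ[K] L)) := by
  have : NumberField L := NumberField.of_module_finite K L
  set 𝔭 := 𝔓.comap (ringOfIntegersToIntBar L) with h𝔭
  have : 𝔭.IsPrime := Ideal.comap_isPrime _ _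
  have : 𝔭.LiesOver 𝔮.asIdeal := ⟨by
    rw [Ideal.over_def 𝔓 𝔮.asIdeal]
    rfl⟩
  let w : HeightOneSpectrum (𝓞 L) := ⟨𝔭, inferInstance, Ideal.ne_bot_of_liesOver_of_ne_bot 𝔮.ne_bot 𝔭⟩
  have : w.asIdeal.LiesOver 𝔮.asIdeal := ‹𝔭.LiesOver 𝔮.asIdeal›
  let g : AbsoluteValue L ℝ := f.comp (f := algebraMap L (AlgebraicClosure K))
    (algebraMap L (AlgebraicClosure K)).injective
  have hfc : f (algebraMap K _ c) ≠ 0 := by simpa using hc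
  have hy : g ((⟨z, hz⟩ : L) ^ p / algebraMap K L c) = 1 := by
    rw [map_div₀, map_pow, div_eq_one_iff_eq]
    · exact hzc
    · exact hfc
  have h1 := valuation_eq_one_of_absoluteValue_eq_one w (g := g)
    (fun x ↦ hle (ringOfIntegersToIntBar L x)) (fun x ↦ hlt (ringOfIntegersToIntBar L x)) hy
  have hcL : w.valuation L (algebraMap K L c) ≠ 0 := by simpa using hc
  rw [map_div₀, map_pow, div_eq_one_iff_eq hcL, ← HeightOneSpectrum.valuation_liesOver L 𝔮 w,
    Ideal.ramificationIdx'_eq_ramificationIdx _ _ 𝔮.ne_bot] at h1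
  have h2 := congrArg WithZero.log h1
  rw [WithZero.log_pow, WithZero.log_pow, nsmul_eq_mul, nsmul_eq_mul] at h2
  -- Since `z ^ p / c` is a unit at `w`, `p * ord_w z = e * ord_𝔮 c`, with `e` the ramification
  -- index.
  have h3 : (p : ℤ) ∣ (w.asIdeal.ramificationIdx (𝓞 K) : ℤ) * ord 𝔮 c := by
    rw [ord, mul_neg, ← h2]
    exact (dvd_mul_right _ _).neg_right
  have h4 := ((Nat.prime_iff_prime_int.1 hp).dvd_or_dvd h3).resolve_right hpc
  rw [Ideal.card_inertia_eq_ramificationIdxIn (G := L ≃ₐ[K] L) 𝔮.asIdeal 𝔭,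
    Ideal.ramificationIdxIn_eq_ramificationIdx 𝔮.asIdeal 𝔭 (L ≃ₐ[K] L)]
  exact Int.natCast_dvd_natCast.1 h4

end Ramification

/-! ### From inertia in a finite extension to the mod `p` image. -/

section ModRep

open IsDedekindDomain NumberField.HeightOneSpectrum

open scoped Classical

variable {K : Type*} [Field K]

theorem galPoint_eq_of_mem_ker {E : WeierstrassCurve K} {N : ℕ} {σ : AbsGal K}
    (hσ : σ ∈ (modRep E N).ker) {P : PointBar E} (hP : N • P = 0) : galPoint E σ P = P := by
  have hP' : P ∈ Torsion E N := (AddSubgroup.torsionBy.nsmul_iff).2 hP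
  have h := congrArg (fun g : LinearMap.GeneralLinearGroup (ZMod N) (Torsion E N) ↦
    ((g : Module.End (ZMod N) (Torsion E N)) ⟨P, hP'⟩ : PointBar E)) (MonoidHom.mem_ker.1 hσ)
  exact h

theorem apply_eq_of_galPoint_eq {E : WeierstrassCurve K} {σ : AbsGal K} {P : PointBar E}
    {x : AlgebraicClosure K} (hx : P.HasX x) (h : galPoint E σ P = P) : σ x = x := by
  obtain ⟨y, h', rfl⟩ := hx
  exact (WeierstrassCurve.Affine.Point.some.inj h).1

/-- The subfield of `K̄` fixed by the kernel of `ρ`, if the latter fixes `z`, contains the normal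
closure of `K(z)`. -/
theorem ker_le_ker_restrictNormalHom {G : Type*} [Group G] (ρ : AbsGal K →* G)
    {z : AlgebraicClosure K} (hz : ∀ σ ∈ ρ.ker, σ z = z)
    [Normal K (IntermediateField.normalClosure K (IntermediateField.adjoin K {z})
      (AlgebraicClosure K))] :
    ρ.ker ≤ (AlgEquiv.restrictNormalHom (IntermediateField.normalClosure K
      (IntermediateField.adjoin K {z}) (AlgebraicClosure K)) :
        AbsGal K →* _).ker := by
  have hle : IntermediateField.normalClosure K (IntermediateField.adjoin K {z})
      (AlgebraicClosure K) ≤ IntermediateField.fixedField ρ.ker := by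
    rw [IntermediateField.normalClosure_def'']
    refine iSup_le fun τ ↦ IntermediateField.map_le_iff_le_comap.2 ?_
    rw [IntermediateField.adjoin_simple_le_iff]
    rintro ⟨σ, hσ⟩
    change σ (τ z) = τ z
    -- The kernel is normal, so `τ⁻¹στ` fixes `z`, hence `σ` fixes the conjugate `τ z`.
    have := hz _ (MonoidHom.normal_ker ρ |>.conj_mem σ hσ τ⁻¹)
    rw [inv_inv] at this
    exact (τ.symm_apply_eq).1 this
  intro σ hσ
  rw [MonoidHom.mem_ker]
  ext x
  exact (AlgEquiv.restrictNormal_commutes σ _ x).trans (hle x.2 ⟨σ, hσ⟩)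

/-- `ψ(S)` is a quotient of `φ(S)`. An infinite `φ(S)` has `Nat.card` zero, which everything
divides. -/
theorem card_map_dvd_card_map {G A B : Type*} [Group G] [Group A] [Group B] (S : Subgroup G)
    {φ : G →* A} {ψ : G →* B} (h : φ.ker ≤ ψ.ker) :
    Nat.card (S.map ψ) ∣ Nat.card (S.map φ) := by
  rw [← Subgroup.relIndex_ker, ← Subgroup.relIndex_ker]
  exact Subgroup.relIndex_dvd_of_le_left S h

/-- If `E` has a `p`-torsion point whose coordinate `x = w z + r` is such that `z ^ p / c` is a
unit at `𝔓`, with `p` not dividing `ord_𝔮 c`, then `p` divides the order of the image of the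
inertia group at `𝔓`. -/
theorem dvd_card_map_modRep [NumberField K] {𝔮 : HeightOneSpectrum (𝓞 K)}
    (E : WeierstrassCurve K) {f : AbsoluteValue (AlgebraicClosure K) ℝ}
    (𝔓 : Ideal (IntBar K)) [𝔓.IsPrime] [𝔓.LiesOver 𝔮.asIdeal]
    (hle : ∀ α : IntBar K, f α ≤ 1) (hlt : ∀ α : IntBar K, α ∈ 𝔓 ↔ f α < 1)
    {p : ℕ} (hp : p.Prime) {c : K} (hc : c ≠ 0) (hpc : ¬ (p : ℤ) ∣ ord 𝔮 c)
    {z : AlgebraicClosure K} (hzc : f z ^ p = f (algebraMap K _ c))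
    {w r : K} (hw : w ≠ 0) {P : PointBar E}
    (hP : P.HasX (algebraMap K _ w * z + algebraMap K _ r)) (hpP : p • P = 0) :
    p ∣ Nat.card ((inertiaSubgroup 𝔓).map (modRep E p)) := by
  let L := IntermediateField.normalClosure K (IntermediateField.adjoin K {z})
    (AlgebraicClosure K)
  have : FiniteDimensional K (IntermediateField.adjoin K {z}) :=
    IntermediateField.adjoin.finiteDimensional (Algebra.IsIntegral.isIntegral z)
  have : FiniteDimensional K L := normalClosure.is_finiteDimensional _ _ _
  have : Normal K L := normalClosure.normal _ _ _
  have : IsGalois K L := { }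
  have hzL : z ∈ L := (IntermediateField.adjoin K {z}).le_normalClosure
    (IntermediateField.mem_adjoin_simple_self K z)
  have hker : (modRep E p).ker ≤ (AlgEquiv.restrictNormalHom L : AbsGal K →* _).ker := by
    refine ker_le_ker_restrictNormalHom _ fun σ hσ ↦ ?_
    have h := apply_eq_of_galPoint_eq hP (galPoint_eq_of_mem_ker hσ hpP)
    rw [map_add, map_mul, AlgEquiv.commutes, AlgEquiv.commutes, add_left_inj] at h
    exact mul_left_cancel₀ (by simpa using hw) h
  refine ((dvd_card_inertia 𝔓 hle hlt L hp hc hpc hzL hzc).trans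
    (Subgroup.card_dvd_of_le fun τ hτ ↦ ?_)).trans (card_map_dvd_card_map _ hker)
  obtain ⟨σ, hσ, rfl⟩ := exists_inertia_restrictNormalHom_eq L 𝔓 hτ
  exact Subgroup.mem_map_of_mem _ hσ

theorem finite_map_modRep (E : WeierstrassCurve K) (N : ℕ)
    (h : {P : PointBar E | N • P = 0}.Finite) (S : Subgroup (AbsGal K)) :
    Finite (S.map (modRep E N)) := by
  have : Finite (Torsion E N) := by
    refine (h.subset fun P hP ↦ ?_).to_subtype
    exact (AddSubgroup.torsionBy.nsmul_iff).1 hP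
  have : Finite (Module.End (ZMod N) (Torsion E N)) := DFunLike.finite _
  have : Finite (LinearMap.GeneralLinearGroup (ZMod N) (Torsion E N)) :=
    inferInstanceAs (Finite (Module.End (ZMod N) (Torsion E N))ˣ)
  infer_instance

end ModRep

/-! ### The valuation of `Δ / c₆²`. -/

section Invariants

open IsDedekindDomain NumberField.HeightOneSpectrum

variable {K : Type*} [Field K] [NumberField K] {𝔮 : HeightOneSpectrum (𝓞 K)}

theorem ord_mul {x y : K} (hx : x ≠ 0) (hy : y ≠ 0) : ord 𝔮 (x * y) = ord 𝔮 x + ord 𝔮 y := by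
  rw [ord, map_mul, WithZero.log_mul (by simpa) (by simpa), neg_add]
  rfl

theorem ord_inv (x : K) : ord 𝔮 x⁻¹ = -ord 𝔮 x := by
  rw [ord, map_inv₀, WithZero.log_inv]
  rfl

theorem one_lt_valuation_of_ord_neg {x : K} (hx : ord 𝔮 x < 0) : 1 < 𝔮.valuation K x := by
  have hx0 : 𝔮.valuation K x ≠ 0 := fun h ↦ by simp [ord, h] at hx
  rw [ord, neg_lt_zero] at hx
  rwa [← WithZero.log_lt_log one_ne_zero hx0, WithZero.log_one]

/-- If `j` is not integral at `𝔮`, then neither is `j - 1728`, with the same valuation. -/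
theorem valuation_j_sub {j : K} (hj : ord 𝔮 j < 0) (n : ℕ) :
    𝔮.valuation K (j - n) = 𝔮.valuation K j := by
  have h := one_lt_valuation_of_ord_neg hj
  apply Valuation.map_sub_eq_of_lt_left
  refine lt_of_le_of_lt ?_ h
  have := 𝔮.valuation_le_one (K := K) (n : 𝓞 K)
  simpa using this

theorem adicAbv_lt_one_of_ord_pos {x : K} (hx : 0 < ord 𝔮 x) : adicAbv K 𝔮 x < 1 := by
  have hx' : ord 𝔮 x⁻¹ < 0 := by rw [ord_inv]; omega
  have h := one_lt_valuation_of_ord_neg hx'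
  have h' : 1 < adicAbv K 𝔮 x⁻¹ := by
    have := WithZeroMulInt.toNNReal_strictMono (one_lt_absNorm_nnreal 𝔮) h
    rw [map_one] at this
    exact_mod_cast this
  rw [map_inv₀] at h'
  exact (one_lt_inv_iff₀.1 h').2

/-- If `j` is not integral at `𝔮`, then `Δ / c₆ ^ 2` is defined and has valuation
`-ord_𝔮 j`. -/
theorem c₄_ne_zero_and_c₆_ne_zero_and_ord_eq {E : WeierstrassCurve K} [E.IsElliptic] (hj : ord 𝔮 E.j < 0) :
    E.c₄ ≠ 0 ∧ E.c₆ ≠ 0 ∧ ord 𝔮 (E.Δ / E.c₆ ^ 2) = -ord 𝔮 E.j := by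
  have hΔ : E.Δ ≠ 0 := E.isUnit_Δ.ne_zero
  have hj' : E.j = E.c₄ ^ 3 / E.Δ := by
    rw [WeierstrassCurve.j, Units.val_inv_eq_inv_val, E.coe_Δ', div_eq_inv_mul]
  -- Thus `Δ / c₆²` is the inverse of `j - 1728`, which has the valuation of `j` because 1728 is
  -- integral.
  have h1728 : E.j - (1728 : ℕ) = E.c₆ ^ 2 / E.Δ := by
    rw [hj']
    field_simp
    have := E.c_relation
    push_cast
    linear_combination -this
  have hv := valuation_j_sub hj 1728
  have h1 := one_lt_valuation_of_ord_neg hj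
  refine ⟨fun h ↦ ?_, fun h ↦ ?_, ?_⟩
  · simp [hj', h] at h1
  · rw [h1728, h] at hv
    simp [← hv] at h1
  · rw [← inv_div, ← h1728, ord_inv, ord, hv, ord]

end Invariants

end EllipticGalois

end

/-! ### Conclusion. -/

theorem mainTheorem8 {K : Type*} [Field K] [NumberField K]
    (E : WeierstrassCurve K) [E.IsElliptic]
    (𝔮 : IsDedekindDomain.HeightOneSpectrum (𝓞 K))
    (p : ℕ) (hp : p.Prime)
    (hneg : EllipticGalois.ord 𝔮 E.j < 0)
    (hndvd : ¬ (p : ℤ) ∣ EllipticGalois.ord 𝔮 E.j)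
    (𝔓 : Ideal (EllipticGalois.IntBar K)) [𝔓.IsPrime] [𝔓.LiesOver 𝔮.asIdeal] :
    Finite ((EllipticGalois.inertiaSubgroup 𝔓).map (EllipticGalois.modRep E p)) ∧
      p ∣ Nat.card ((EllipticGalois.inertiaSubgroup 𝔓).map (EllipticGalois.modRep E p)) := by
  classical
  obtain ⟨f, hf, hfK, hle, hlt⟩ := EllipticGalois.exists_absoluteValue_center (𝔮 := 𝔮) 𝔓
  obtain ⟨h₄, h₆, hord⟩ := EllipticGalois.c₄_ne_zero_and_c₆_ne_zero_and_ord_eq hneg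
  have hδ0 : E.Δ / E.c₆ ^ 2 ≠ 0 := div_ne_zero E.isUnit_Δ.ne_zero (pow_ne_zero 2 h₆)
  have hw : -E.c₆ / E.c₄ ≠ 0 := div_ne_zero (neg_ne_zero.2 h₆) h₄
  let W := (E.baseChange (AlgebraicClosure K)).toAffine
  have : CharZero (AlgebraicClosure K) := algebraRat.charZero _
  let φ := algebraMap K (AlgebraicClosure K)
  have : W.IsElliptic := inferInstanceAs (E.map φ).IsElliptic
  have hWc₄ : W.c₄ = φ E.c₄ := E.map_c₄ φ
  have hWc₆ : W.c₆ = φ E.c₆ := E.map_c₆ φ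
  have hWΔ : W.Δ = φ E.Δ := E.map_Δ φ
  have hWb₂ : W.b₂ = φ E.b₂ := E.map_b₂ φ
  have hcoord : W.IsTateCoordinate (φ ((-E.c₆ / E.c₄ - E.b₂) / 12)) (φ (-E.c₆ / E.c₄))
      (φ (E.Δ / E.c₆ ^ 2)) := by
    have := WeierstrassCurve.Affine.isTateCoordinate W
      (by rw [hWc₄]; simpa [φ] using h₄) (by rw [hWc₆]; simpa [φ] using h₆)
    rw [hWc₄, hWc₆, hWΔ, hWb₂] at this
    simpa only [map_div₀, map_sub, map_neg, map_pow, map_ofNat] using this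
  obtain ⟨n, hn⟩ := AbsoluteValue.exists_val f (x := φ (E.Δ / E.c₆ ^ 2)) (by simpa [φ] using hδ0)
  have hn0 : 0 < n := by
    have h := EllipticGalois.adicAbv_lt_one_of_ord_pos (x := E.Δ / E.c₆ ^ 2) (𝔮 := 𝔮) (by omega)
    rwa [← hfK, hn, Real.exp_lt_one_iff, neg_lt_zero] at h
  rcases hp.eq_two_or_odd' with rfl | ⟨q, rfl⟩
  · obtain ⟨e, he⟩ := AbsoluteValue.exists_val f (x := (4 : AlgebraicClosure K)) (by norm_num)
    obtain ⟨P, z, hP, hz, h2P⟩ := hcoord.exists_torsion_two hf hn hn0 he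
    refine ⟨EllipticGalois.finite_map_modRep E 2
      WeierstrassCurve.Affine.finite_two_torsion _, ?_⟩
    -- The factor 4 changes the order by an even number, so `ord (4δ)` is odd along with `ord j`,
    -- even when `𝔮` divides 2.
    have h2 : EllipticGalois.ord 𝔮 (4 * (E.Δ / E.c₆ ^ 2)) =
        2 * EllipticGalois.ord 𝔮 (2 : K) - EllipticGalois.ord 𝔮 E.j := by
      rw [show (4 : K) = 2 * 2 by norm_num, EllipticGalois.ord_mul (by norm_num) hδ0,
        EllipticGalois.ord_mul two_ne_zero two_ne_zero, hord]
      ring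
    refine EllipticGalois.dvd_card_map_modRep E 𝔓 hle hlt hp (c := 4 * (E.Δ / E.c₆ ^ 2))
      (mul_ne_zero (by norm_num) hδ0) (by rw [h2]; push_cast at hndvd ⊢; omega) (z := z) ?_ hw hP h2P
    have h4 : f.Val (4 * φ (E.Δ / E.c₆ ^ 2)) (e + n) := he.mul hn
    rw [map_mul, map_ofNat]
    have := hz.pow 2
    rw [← map_pow, this, h4]
    congr 1
    push_cast
    ring
  · have hq : 1 ≤ q := by
      by_contra! h
      obtain rfl : q = 0 := by omega
      exact hp.ne_one rfl
    obtain ⟨hx, P, z, hP, hz, hpP⟩ := hcoord.exists_torsion_odd hf hn hn0 hq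
    refine ⟨EllipticGalois.finite_map_modRep E _
      (WeierstrassCurve.Affine.finite_torsion_of_xFractionSub_ne_zero hp (by omega) hx) _, ?_⟩
    refine EllipticGalois.dvd_card_map_modRep E 𝔓 hle hlt hp hδ0
      (by rwa [hord, dvd_neg]) (z := z) ?_ hw hP hpP
    have := hz.pow (2 * q + 1)
    rw [← map_pow, this, hn]
    congr 1
    push_cast
    field_simp
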